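/- Let $N\in\mathbb N$. A \emph{weight function} is a continuous non-decreasing function $\omega:[0,\infty)\to[0,\infty)$ such that: $(\alpha)$ there is $K\ge 1$ with $\omega(2t)\le K(1+\omega(t))$ for all $t\ge 0$; $(\beta)$ $\omega(t)=o(t)$ as $t\to\infty$; $(\gamma)$ there are $a\in\mathbb R$, $b>0$ with $\omega(t)\ge a+b\log(1+t)$ for all $t\ge0$; $(\delta)$ $t\mapsto\omega(e^t)$ is convex on $\mathbb R$. Put $\omega(x):=\omega(|x|)$ for $x\in\mathbb R^N$ and $\omega(x,\xi):=\omega(|(x,\xi)|)$ for $(x,\xi)\in\mathbb R^{2N}$, with Euclidean norms. Let $\hat f(\xi)=\int_{\mathbb R^N}e^{-ix\cdot\xi}f(x)\,dx$, and let $\mathcal S_\omega(\mathbb R^N)$ be the set of $f\in L^1(\mathbb R^N)$ with $f,\hat f\in C^\infty(\mathbb R^N)$ and $\|e^{\lambda\omega}\partial^\alpha f\|_\infty<\infty$, $\|e^{\lambda\omega}\partial^\alpha\hat f\|_\infty<\infty$ for all $\lambda>0$ and all multi-indices $\alpha\in\mathbb N_0^N$. For $f,g\in\mathcal S_\omega(\mathbb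 R^N)$, $\tau\in[0,1]$ and $(x,\xi)\in\mathbb R^{2N}$ put $$V_gf(x,\xi)=\int_{\mathbb R^N}f(y)\overline{g(y-x)}e^{-iy\cdot\xi}\,dy,\qquad \mathrm{Sp}_gf=|V_gf|^2,$$ $$\mathrm{Wig}_\tau(f)(x,\xi)=\int_{\mathbb R^N}e^{-it\cdot\xi}f(x+\tau t)\overline{f(x-(1-\tau)t)}\,dt .$$ For $q\in[1,\infty]$ let $q'$ be the conjugate exponent, $\frac1q+\frac1{q'}=1$ (so $(2p)'=1$ for $p=\infty$). Let $\omega$ be a weight function, let $K\ge1$ be any constant for which $(\alpha)$ holds and $a\in\mathbb R$, $b>0$ any constants for which $(\gamma)$ holds. Let $1\le p\le\infty$, $\tau\in(0,1)$, $g\in\mathcal S_\omega(\mathbb R^N)$, $g\ne0$, and $\tilde g(t):=g(-t)$. Norms of functions of $(x,\xi)$ are taken over $\mathbb R^{2N}$. (i) For every $\lambda\ge0$ the constant $D^{(5)}_\lambda=e^{K\lambda}\,\|e^{K\lambda\omega}\,\mathrm{Wig}_{1-\tau}(\tilde g)\|_{p'}$ is finite, and for every $f\in\mathcal S_\omega(\mathbb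 R^N)$ the right-hand norm below is finite and $$\|e^{\lambda\omega}\,\mathrm{Sp}_gf\|_\infty\le D^{(5)}_\lambda\,\|e^{K\lambda\omega}\,\mathrm{Wig}_\tau(f)\|_p .$$ (ii) For every $\lambda\ge0$ and every $\mu>\frac{2N}{b}\bigl(K^2+\frac{2}{(2p)'}\bigr)$ the constant $$D^{(6)}_{\lambda,\mu}=\frac{e^{\frac K2(1+2K)\lambda}}{(2\pi)^{\frac52N}(\tau-\tau^2)^{\frac N2}\|g\|_2^4}\ \inf_{\mu',\mu''}\Bigl[e^{K(1+2K)(4K^2\lambda+\mu')}\,\|e^{K^2(4K^2\lambda+\mu')\omega}g\|_\infty\,\|e^{K^2(4K^2\lambda+\mu')\omega}\hat g\|_\infty\,\|e^{-\mu'\omega}\|_{L^2(\mathbb R^{2N})}\,\|e^{-\mu''\omega}\|^2_{L^{(2p)'}(\mathbb R^{2N})}\Bigr],$$ the infimum being over all real $\mu',\mu''$ with $2(K^2\mu'+\mu'')=\mu$, $\mu'>\frac Nb$, $\mu''>\frac{2N}{b(2p)'}$, is finite, and for every $f\in\mathcal S_\omega(\mathbb R^N)$ the right-hand norm below is finite and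 $$\|e^{\lambda\omega}\,\mathrm{Wig}_\tau(f)\|_\infty\le D^{(6)}_{\lambda,\mu}\,\|e^{(8K^4\lambda+\mu)\omega}\,\mathrm{Sp}_gf\|_p .$$ -/

import Mathlib

open scoped ENNReal

/-- Condition `(α)` with constant `K`. -/
def WeightAlpha (ω : ℝ → ℝ) (K : ℝ) : Prop :=
  1 ≤ K ∧ ∀ t : ℝ, 0 ≤ t → ω (2 * t) ≤ K * (1 + ω t)

/-- Condition `(γ)` with constants `a` and `b`. -/
def WeightGamma (ω : ℝ → ℝ) (a b : ℝ) : Prop :=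
  0 < b ∧ ∀ t : ℝ, 0 ≤ t → a + b * Real.log (1 + t) ≤ ω t

/-- Weight functions `ω : [0,∞) → [0,∞)`. Only the values of `ω` on `[0,∞)` are ever used. -/
structure IsWeightFunction (ω : ℝ → ℝ) : Prop where
  continuousOn : ContinuousOn ω (Set.Ici 0)
  monotoneOn : MonotoneOn ω (Set.Ici 0)
  nonneg : ∀ t : ℝ, 0 ≤ t → 0 ≤ ω t
  alpha : ∃ K : ℝ, WeightAlpha ω K
  beta : ω =o[Filter.atTop] (fun t : ℝ => t)
  gamma : ∃ a b : ℝ, WeightGamma ω a b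
  delta : ConvexOn ℝ Set.univ (fun t : ℝ => ω (Real.exp t))

/-- `ℝ^N` with its Euclidean norm and Lebesgue measure. -/
abbrev RN (N : ℕ) : Type := EuclideanSpace ℝ (Fin N)

/-- The Euclidean norm of `(x, ξ) ∈ ℝ^N × ℝ^N = ℝ^{2N}` (the norm that Mathlib puts on a product
is the maximum norm). The measure on `RN N × RN N` is the product measure, that is, Lebesgue
measure on `ℝ^{2N}`. -/
noncomputable def phaseNorm {N : ℕ} (z : RN N × RN N) : ℝ :=
  Real.sqrt (‖z.1‖ ^ 2 + ‖z.2‖ ^ 2)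

/-- The partial derivative in the `i`-th coordinate direction. -/
noncomputable def partialD {N : ℕ} (i : Fin N) (f : RN N → ℂ) : RN N → ℂ :=
  fun x => fderiv ℝ f x (EuclideanSpace.single i 1)

/-- `∂^α = ∂_1^{α_1} ⋯ ∂_N^{α_N}` for a multi-index `α`. -/
noncomputable def multiD {N : ℕ} (α : Fin N → ℕ) (f : RN N → ℂ) : RN N → ℂ :=
  (List.finRange N).foldr (fun i h => (partialD i)^[α i] h) f

/-- The Fourier transform `f̂(ξ) = ∫ e^{-i x·ξ} f(x) dx`. -/
noncomputable def fourierHat {N : ℕ} (f : RN N → ℂ) (ξ : RN N) : ℂ :=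
  ∫ x : RN N, Complex.exp (-(Complex.I * ((inner ℝ x ξ : ℝ) : ℂ))) * f x

/-- The space `S_ω(ℝ^N)`. The functions involved are continuous, so the supremum norms are
given by pointwise bounds. -/
structure MemSω {N : ℕ} (ω : ℝ → ℝ) (f : RN N → ℂ) : Prop where
  integrable : MeasureTheory.Integrable f
  smooth : ContDiff ℝ ((⊤ : ℕ∞) : WithTop ℕ∞) f
  smooth_hat : ContDiff ℝ ((⊤ : ℕ∞) : WithTop ℕ∞) (fourierHat f)
  bound : ∀ lam : ℝ, 0 < lam → ∀ α : Fin N → ℕ, ∃ C : ℝ, ∀ x : RN N,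
    Real.exp (lam * ω ‖x‖) * ‖multiD α f x‖ ≤ C
  bound_hat : ∀ lam : ℝ, 0 < lam → ∀ α : Fin N → ℕ, ∃ C : ℝ, ∀ x : RN N,
    Real.exp (lam * ω ‖x‖) * ‖multiD α (fourierHat f) x‖ ≤ C

/-- The short-time Fourier transform `V_g f(x, ξ) = ∫ f(y) conj(g(y - x)) e^{-i y·ξ} dy`. -/
noncomputable def stft {N : ℕ} (g f : RN N → ℂ) (z : RN N × RN N) : ℂ :=
  ∫ y : RN N, f y * (starRingEnd ℂ) (g (y - z.1)) *
    Complex.exp (-(Complex.I * ((inner ℝ y z.2 : ℝ) : ℂ)))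

/-- The spectrogram `Sp_g f = |V_g f|²`. -/
noncomputable def spectrogram {N : ℕ} (g f : RN N → ℂ) (z : RN N × RN N) : ℝ :=
  ‖stft g f z‖ ^ 2

/-- The `τ`-Wigner transform
`Wig_τ(f)(x, ξ) = ∫ e^{-i t·ξ} f(x + τ t) conj(f(x - (1 - τ) t)) dt`. -/
noncomputable def wig {N : ℕ} (τ : ℝ) (f : RN N → ℂ) (z : RN N × RN N) : ℂ :=
  ∫ t : RN N, Complex.exp (-(Complex.I * ((inner ℝ t z.2 : ℝ) : ℂ))) *
    f (z.1 + τ • t) * (starRingEnd ℂ) (f (z.1 - (1 - τ) • t))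

/-- The weighted norm `‖e^{sω} f‖_{L^p(ℝ^N)}`. -/
noncomputable def wNorm {N : ℕ} (ω : ℝ → ℝ) (s : ℝ) (f : RN N → ℂ) (p : ℝ≥0∞) : ℝ≥0∞ :=
  MeasureTheory.eLpNorm (fun x : RN N => Real.exp (s * ω ‖x‖) • f x) p MeasureTheory.volume

/-- The weighted norm `‖e^{sω} F‖_{L^p(ℝ^{2N})}`, for real or complex valued `F`. -/
noncomputable def wNormPhase {N : ℕ} {V : Type*} [NormedAddCommGroup V] [NormedSpace ℝ V]
    (ω : ℝ → ℝ) (s : ℝ) (F : RN N × RN N → V) (p : ℝ≥0∞) : ℝ≥0∞ :=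
  MeasureTheory.eLpNorm (fun z : RN N × RN N => Real.exp (s * ω (phaseNorm z)) • F z) p
    MeasureTheory.volume

/-- The norm `‖e^{-sω}‖_{L^p(ℝ^{2N})}`. -/
noncomputable def expNormPhase (N : ℕ) (ω : ℝ → ℝ) (s : ℝ) (p : ℝ≥0∞) : ℝ≥0∞ :=
  MeasureTheory.eLpNorm (fun z : RN N × RN N => Real.exp (-s * ω (phaseNorm z))) p
    MeasureTheory.volume

/-- `D^{(5)}_λ = e^{Kλ} ‖e^{Kλω} Wig_{1-τ}(g̃)‖_{p'}` with `g̃(t) = g(-t)`. -/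
noncomputable def constD5 {N : ℕ} (ω : ℝ → ℝ) (K : ℝ) (p : ℝ≥0∞) (τ : ℝ) (g : RN N → ℂ)
    (lam : ℝ) : ℝ≥0∞ :=
  ENNReal.ofReal (Real.exp (K * lam)) *
    wNormPhase ω (K * lam) (wig (1 - τ) (fun t => g (-t))) (ENNReal.conjExponent p)

/-- The constant `D^{(6)}_{λ,μ}`; the infimum runs over all real `μ'`, `μ''` (here `m₁`, `m₂`)
with `2(K²μ' + μ'') = μ`, `μ' > N/b` and `μ'' > 2N/(b(2p)')`. -/
noncomputable def constD6 {N : ℕ} (ω : ℝ → ℝ) (K b : ℝ) (p : ℝ≥0∞) (τ : ℝ) (g : RN N → ℂ)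
    (lam μ : ℝ) : ℝ≥0∞ :=
  ENNReal.ofReal (Real.exp (K / 2 * (1 + 2 * K) * lam)) /
    (ENNReal.ofReal ((2 * Real.pi) ^ ((5 / 2 : ℝ) * (N : ℝ)) *
        (τ - τ ^ 2) ^ ((N : ℝ) / 2)) *
      MeasureTheory.eLpNorm g 2 MeasureTheory.volume ^ 4) *
  ⨅ (m₁ : ℝ) (m₂ : ℝ) (_ : 2 * (K ^ 2 * m₁ + m₂) = μ ∧ (N : ℝ) / b < m₁ ∧
      2 * (N : ℝ) / (b * (ENNReal.conjExponent (2 * p)).toReal) < m₂),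
    ENNReal.ofReal (Real.exp (K * (1 + 2 * K) * (4 * K ^ 2 * lam + m₁))) *
      wNorm ω (K ^ 2 * (4 * K ^ 2 * lam + m₁)) g ∞ *
      wNorm ω (K ^ 2 * (4 * K ^ 2 * lam + m₁)) (fourierHat g) ∞ *
      expNormPhase N ω m₁ 2 *
      expNormPhase N ω m₂ (ENNReal.conjExponent (2 * p)) ^ 2

open MeasureTheory

/-! ### Weights -/

/-! Both inequalities come from an integral formula for one transform in terms of the other,
followed by pointwise weight estimates and Hölder.

For (i), the spectrogram is, up to a factor `(2π)^{-N}`, the convolution of `Wig_τ(f)` with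
`Wig_{1-τ}(g̃)`. Indeed `|V_g f|²` is a double integral in `(u, v)`; in the coordinates `u = y +
τt`, `v = y - (1-τ)t` the integral over `t` is a Parseval pairing of two correlations whose Fourier
transforms are Wigner transforms. `enorm_spectrogram_le` records the resulting bound. By `(α)`,
`ω(z) ≤ K(1 + ω(w) + ω(z-w))`, so the weight distributes over the convolution and Hölder finishes
(`wNormPhase_top_spectrogram_le`).

For (ii), the inversion formula `∫ V_g f(z) π(z)g dz = (2π)^N ‖g‖₂² f` is inserted into both slots
of the Wigner transform. By covariance (`enorm_crossWig_tfShift`), the cross-Wigner transform of two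
shifts of `g` is, in modulus, `Wig_τ(g)` translated by a point `Z` whose components are convex
combinations of those of `z₁` and `z₂`. This gives `enorm_wig_le_lintegral_stft`. The decay of
`Wig_τ(g)` is made explicit in `norm_wig_le`: `g` bounds it with decay in `x`, Parseval and `ĝ`
bound it with decay in `ξ`, and the geometric mean of the two bounds decays in both. Hence the
weighted kernel is at most a product of a function of `z₁` and the same function of `z₂`, the double
integral becomes a square, and Hölder with exponents `2p` and `(2p)'` yields the estimate for each
admissible pair (`wNormPhase_top_wig_le`). The infimum is taken last.

All norms are finite because the transforms decay faster than every `e^{-sω}`, while by `(γ)`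
`e^{-sω}` is integrable for large `s`. -/

theorem phaseNorm_nonneg {N : ℕ} (z : RN N × RN N) : 0 ≤ phaseNorm z := Real.sqrt_nonneg _

theorem norm_fst_le_phaseNorm {N : ℕ} (z : RN N × RN N) : ‖z.1‖ ≤ phaseNorm z :=
  Real.le_sqrt_of_sq_le (by nlinarith [sq_nonneg ‖z.2‖])

theorem norm_snd_le_phaseNorm {N : ℕ} (z : RN N × RN N) : ‖z.2‖ ≤ phaseNorm z :=
  Real.le_sqrt_of_sq_le (by nlinarith [sq_nonneg ‖z.1‖])

theorem norm_le_phaseNorm {N : ℕ} (z : RN N × RN N) : ‖z‖ ≤ phaseNorm z :=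
  max_le (norm_fst_le_phaseNorm z) (norm_snd_le_phaseNorm z)

theorem continuous_phaseNorm {N : ℕ} : Continuous (phaseNorm : RN N × RN N → ℝ) := by
  unfold phaseNorm
  fun_prop

theorem phaseNorm_le_two_mul_max {N : ℕ} (z : RN N × RN N) :
    phaseNorm z ≤ 2 * max ‖z.1‖ ‖z.2‖ := by
  refine Real.sqrt_le_iff.2 ⟨by positivity, ?_⟩
  have h1 := le_max_left ‖z.1‖ ‖z.2‖
  have h2 := le_max_right ‖z.1‖ ‖z.2‖
  nlinarith [norm_nonneg z.1, norm_nonneg z.2]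

/-- The Euclidean norm on `ℝ^{2N}` is the norm of `WithLp 2`. -/
theorem phaseNorm_eq_norm {N : ℕ} (z : RN N × RN N) : phaseNorm z = ‖WithLp.toLp 2 z‖ := by
  rw [WithLp.prod_norm_eq_of_L2]
  rfl

theorem phaseNorm_add_le {N : ℕ} (z w : RN N × RN N) :
    phaseNorm (z + w) ≤ phaseNorm z + phaseNorm w := by
  simp only [phaseNorm_eq_norm, WithLp.toLp_add]
  exact norm_add_le _ _

instance instIsAddHaarMeasurePhase {N : ℕ} :
    (volume : Measure (RN N × RN N)).IsAddHaarMeasure :=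
  inferInstanceAs ((volume : Measure (RN N)).prod volume).IsAddHaarMeasure

section Weight

variable {ω : ℝ → ℝ} {K a b : ℝ}

theorem IsWeightFunction.continuous_comp (hω : IsWeightFunction ω) {X : Type*}
    [TopologicalSpace X] {φ : X → ℝ} (hφ : Continuous φ) (h0 : ∀ x, 0 ≤ φ x) :
    Continuous fun x => ω (φ x) :=
  hω.continuousOn.comp_continuous hφ h0

theorem IsWeightFunction.continuous_norm (hω : IsWeightFunction ω) {E : Type*}
    [NormedAddCommGroup E] : Continuous fun x : E => ω ‖x‖ :=
  hω.continuous_comp _root_.continuous_norm fun _ => norm_nonneg _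

theorem IsWeightFunction.continuous_phase (hω : IsWeightFunction ω) {N : ℕ} :
    Continuous fun z : RN N × RN N => ω (phaseNorm z) :=
  hω.continuous_comp continuous_phaseNorm phaseNorm_nonneg

/-- Monotonicity and nonnegativity suffice, so no factor `K` is lost. This is why convex
combinations are better than sums in the estimates below. -/
theorem IsWeightFunction.le_add_of_le_max (hω : IsWeightFunction ω) {r u v : ℝ} (hr : 0 ≤ r)
    (hu : 0 ≤ u) (hv : 0 ≤ v) (h : r ≤ max u v) : ω r ≤ ω u + ω v := by
  have h1 := hω.nonneg u hu
  have h2 := hω.nonneg v hv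
  rcases le_max_iff.1 h with h | h
  · linarith [hω.monotoneOn hr hu h]
  · linarith [hω.monotoneOn hr hv h]

theorem IsWeightFunction.le_of_le_two_mul_max (hω : IsWeightFunction ω) (hK : WeightAlpha ω K)
    {r u v : ℝ} (hr : 0 ≤ r) (hu : 0 ≤ u) (hv : 0 ≤ v) (h : r ≤ 2 * max u v) :
    ω r ≤ K * (1 + (ω u + ω v)) := by
  have hm : 0 ≤ max u v := le_max_of_le_left hu
  have hK0 : 0 ≤ K := zero_le_one.trans hK.1
  calc ω r ≤ ω (2 * max u v) := hω.monotoneOn hr (by simpa using hm) h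
    _ ≤ K * (1 + ω (max u v)) := hK.2 _ hm
    _ ≤ _ := by gcongr; exact hω.le_add_of_le_max hm hu hv le_rfl

theorem IsWeightFunction.le_of_le_add (hω : IsWeightFunction ω) (hK : WeightAlpha ω K)
    {r u v : ℝ} (hr : 0 ≤ r) (hu : 0 ≤ u) (hv : 0 ≤ v) (h : r ≤ u + v) :
    ω r ≤ K * (1 + (ω u + ω v)) :=
  hω.le_of_le_two_mul_max hK hr hu hv
    (by linarith [le_max_left u v, le_max_right u v])

theorem IsWeightFunction.phase_le (hω : IsWeightFunction ω) (hK : WeightAlpha ω K) {N : ℕ}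
    (z : RN N × RN N) : ω (phaseNorm z) ≤ K * (1 + (ω ‖z.1‖ + ω ‖z.2‖)) :=
  hω.le_of_le_two_mul_max hK (phaseNorm_nonneg z) (norm_nonneg _) (norm_nonneg _)
    (phaseNorm_le_two_mul_max z)

theorem IsWeightFunction.phase_add_le (hω : IsWeightFunction ω) (hK : WeightAlpha ω K) {N : ℕ}
    (z w : RN N × RN N) :
    ω (phaseNorm (z + w)) ≤ K * (1 + (ω (phaseNorm z) + ω (phaseNorm w))) :=
  hω.le_of_le_add hK (phaseNorm_nonneg _) (phaseNorm_nonneg _) (phaseNorm_nonneg _)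
    (phaseNorm_add_le z w)

/-- Condition `(γ)` makes `e^{-sω}` decay polynomially of order `sb`, which is integrable once `sb`
exceeds the dimension; hence the thresholds `N/b` and `2N/b`. The separate `r ≤ t` allows the
Euclidean norm to be compared with the maximum norm of a product. -/
theorem WeightGamma.exp_neg_le (hb : WeightGamma ω a b) {s r t : ℝ} (hs : 0 ≤ s) (hr : 0 ≤ r)
    (ht : 0 ≤ t) (hrt : r ≤ t) :
    Real.exp (-s * ω t) ≤ Real.exp (-s * a) * (1 + r) ^ (-(s * b)) := by
  have h1 := hb.2 t ht
  have h2 : Real.log (1 + r) ≤ Real.log (1 + t) := Real.log_le_log (by linarith) (by linarith)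
  rw [Real.rpow_def_of_pos (by linarith), ← Real.exp_add]
  have h3 : b * Real.log (1 + r) ≤ b * Real.log (1 + t) := mul_le_mul_of_nonneg_left h2 hb.1.le
  exact Real.exp_le_exp.2 (by nlinarith)

theorem IsWeightFunction.integrable_exp_neg (hω : IsWeightFunction ω) (hb : WeightGamma ω a b)
    {N : ℕ} {s : ℝ} (hs : (N : ℝ) / b < s) : Integrable fun x : RN N => Real.exp (-s * ω ‖x‖) := by
  have hs0 : 0 ≤ s := (div_nonneg (Nat.cast_nonneg _) hb.1.le).trans hs.le
  have hN : (Module.finrank ℝ (RN N) : ℝ) < s * b := by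
    rw [finrank_euclideanSpace_fin]
    exact (div_lt_iff₀ hb.1).1 hs
  refine ((integrable_one_add_norm (μ := volume) hN).const_mul (Real.exp (-s * a))).mono'
    (Real.continuous_exp.comp (continuous_const.mul hω.continuous_norm)).aestronglyMeasurable ?_
  filter_upwards with x
  rw [Real.norm_of_nonneg (Real.exp_nonneg _)]
  exact hb.exp_neg_le hs0 (norm_nonneg _) (norm_nonneg _) le_rfl

theorem IsWeightFunction.integrable_exp_neg_phase (hω : IsWeightFunction ω)
    (hb : WeightGamma ω a b) {N : ℕ} {s : ℝ} (hs : 2 * (N : ℝ) / b < s) :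
    Integrable fun z : RN N × RN N => Real.exp (-s * ω (phaseNorm z)) := by
  have hs0 : 0 ≤ s := (div_nonneg (by positivity) hb.1.le).trans hs.le
  have hN : (Module.finrank ℝ (RN N × RN N) : ℝ) < s * b := by
    rw [Module.finrank_prod, finrank_euclideanSpace_fin]
    push_cast
    rw [← two_mul]
    exact (div_lt_iff₀ hb.1).1 hs
  refine ((integrable_one_add_norm (μ := volume) hN).const_mul (Real.exp (-s * a))).mono'
    (Real.continuous_exp.comp (continuous_const.mul hω.continuous_phase)).aestronglyMeasurable ?_
  filter_upwards with z
  rw [Real.norm_of_nonneg (Real.exp_nonneg _)]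
  exact hb.exp_neg_le hs0 (norm_nonneg _) (phaseNorm_nonneg _) (norm_le_phaseNorm z)

theorem expNormPhase_lt_top (hω : IsWeightFunction ω) (hb : WeightGamma ω a b) {N : ℕ} {s : ℝ}
    {p : ℝ≥0∞} (hp0 : p ≠ 0) (hp : p ≠ ∞) (hs : 2 * (N : ℝ) / b < s * p.toReal) :
    expNormPhase N ω s p < ∞ := by
  rw [expNormPhase, eLpNorm_lt_top_iff_lintegral_rpow_enorm_lt_top hp0 hp]
  have h := (hω.integrable_exp_neg_phase hb hs).2
  rw [hasFiniteIntegral_iff_enorm] at h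
  refine (lintegral_congr fun z => ?_).trans_lt h
  rw [Real.enorm_of_nonneg (Real.exp_nonneg _), Real.enorm_of_nonneg (Real.exp_nonneg _),
    ENNReal.ofReal_rpow_of_pos (Real.exp_pos _), ← Real.exp_mul]
  ring_nf

end Weight

/-! ### Exponential decay and finiteness of weighted norms -/

/-- Continuous functions all of whose exponentially weighted sup norms are finite. -/
structure HasExpDecay {N : ℕ} (ω : ℝ → ℝ) (f : RN N → ℂ) : Prop where
  continuous : Continuous f
  bound : ∀ s : ℝ, ∃ C : ℝ, ∀ x : RN N, Real.exp (s * ω ‖x‖) * ‖f x‖ ≤ C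

section Decay

variable {N : ℕ} {ω : ℝ → ℝ} {f : RN N → ℂ}

theorem multiD_zero (f : RN N → ℂ) : multiD 0 f = f := by
  unfold multiD
  simp

theorem HasExpDecay.of_pos (hω : IsWeightFunction ω) (hf : Continuous f)
    (h : ∀ s : ℝ, 0 < s → ∃ C : ℝ, ∀ x : RN N, Real.exp (s * ω ‖x‖) * ‖f x‖ ≤ C) :
    HasExpDecay ω f := by
  refine ⟨hf, fun s => ?_⟩
  obtain ⟨C, hC⟩ := h (max s 1) (lt_max_of_lt_right one_pos)
  refine ⟨C, fun x => le_trans ?_ (hC x)⟩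
  gcongr
  · exact hω.nonneg _ (norm_nonneg _)
  · exact le_max_left _ _

theorem MemSω.hasExpDecay (hω : IsWeightFunction ω) (hf : MemSω ω f) : HasExpDecay ω f :=
  .of_pos hω hf.smooth.continuous fun s hs => by simpa [multiD_zero] using hf.bound s hs 0

theorem MemSω.hasExpDecay_hat (hω : IsWeightFunction ω) (hf : MemSω ω f) :
    HasExpDecay ω (fourierHat f) :=
  .of_pos hω hf.smooth_hat.continuous fun s hs => by simpa [multiD_zero] using hf.bound_hat s hs 0

theorem HasExpDecay.comp_neg (hf : HasExpDecay ω f) : HasExpDecay ω fun t => f (-t) :=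
  ⟨hf.continuous.comp continuous_neg, fun s => by
    obtain ⟨C, hC⟩ := hf.bound s
    exact ⟨C, fun x => by simpa using hC (-x)⟩⟩

theorem fourierHat_comp_neg (f : RN N → ℂ) :
    fourierHat (fun t => f (-t)) = fun ξ => fourierHat f (-ξ) := by
  ext ξ
  unfold fourierHat
  rw [← integral_neg_eq_self]
  simp

theorem norm_le_exp_neg_mul {s C r : ℝ} {c : ℂ} (h : Real.exp (s * r) * ‖c‖ ≤ C) :
    ‖c‖ ≤ C * Real.exp (-s * r) := by
  have : ‖c‖ = Real.exp (s * r) * ‖c‖ * Real.exp (-s * r) := by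
    rw [mul_right_comm, ← Real.exp_add]
    simp
  rw [this]
  gcongr

theorem HasExpDecay.integrable (hω : IsWeightFunction ω) (hf : HasExpDecay ω f) :
    Integrable f := by
  obtain ⟨a, b, hb⟩ := hω.gamma
  obtain ⟨s, hs⟩ := exists_gt ((N : ℝ) / b)
  obtain ⟨C, hC⟩ := hf.bound s
  refine ((hω.integrable_exp_neg hb hs).const_mul C).mono' hf.continuous.aestronglyMeasurable ?_
  filter_upwards with x
  exact norm_le_exp_neg_mul (hC x)

theorem HasExpDecay.exists_norm_le (hf : HasExpDecay ω f) : ∃ C : ℝ, ∀ x, ‖f x‖ ≤ C := by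
  simpa using hf.bound 0

/-- The set where a continuous function exceeds its essential supremum is open and null, hence
empty. -/
theorem Continuous.norm_le_of_eLpNorm_top {X E : Type*} [TopologicalSpace X] [MeasurableSpace X]
    [NormedAddCommGroup E] {μ : Measure X} [μ.IsOpenPosMeasure] {h : X → E} (hh : Continuous h)
    (hfin : eLpNorm h ∞ μ ≠ ∞) (x : X) : ‖h x‖ ≤ (eLpNorm h ∞ μ).toReal := by
  by_contra! hx
  have hU : IsOpen {y | (eLpNorm h ∞ μ).toReal < ‖h y‖} := isOpen_lt continuous_const hh.norm
  refine (hU.measure_pos μ ⟨x, hx⟩).ne' ?_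
  rw [eLpNorm_exponent_top] at *
  have := ae_le_eLpNormEssSup (f := h) (μ := μ)
  refine measure_mono_null (fun y hy => ?_) (ae_iff.1 this)
  rw [Set.mem_ofPred_eq] at hy ⊢
  rw [not_le, ← ofReal_norm, ← ENNReal.ofReal_toReal hfin]
  exact (ENNReal.ofReal_lt_ofReal_iff (ENNReal.toReal_nonneg.trans_lt hy)).2 hy

theorem HasExpDecay.wNorm_lt_top (hf : HasExpDecay ω f) (s : ℝ) : wNorm ω s f ∞ < ∞ := by
  obtain ⟨C, hC⟩ := hf.bound s
  refine eLpNormEssSup_lt_top_of_ae_bound (C := C) (.of_forall fun x => ?_)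
  rw [norm_smul, Real.norm_of_nonneg (Real.exp_nonneg _)]
  exact hC x

theorem HasExpDecay.exp_mul_norm_le (hω : IsWeightFunction ω) (hf : HasExpDecay ω f) (s : ℝ)
    (x : RN N) : Real.exp (s * ω ‖x‖) * ‖f x‖ ≤ (wNorm ω s f ∞).toReal := by
  have hc : Continuous fun x : RN N => Real.exp (s * ω ‖x‖) • f x :=
    (Real.continuous_exp.comp (continuous_const.mul hω.continuous_norm)).smul hf.continuous
  have := hc.norm_le_of_eLpNorm_top (μ := volume) (hf.wNorm_lt_top s).ne x
  rwa [norm_smul, Real.norm_of_nonneg (Real.exp_nonneg _)] at this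

end Decay

/-- Measurable functions on phase space with exponential decay have finite weighted norms. -/
theorem wNormPhase_lt_top {N : ℕ} {ω : ℝ → ℝ} (hω : IsWeightFunction ω) {V : Type*}
    [NormedAddCommGroup V] [NormedSpace ℝ V] {F : RN N × RN N → V}
    (h : ∀ s : ℝ, ∃ C : ℝ, ∀ z, Real.exp (s * ω (phaseNorm z)) * ‖F z‖ ≤ C) (s : ℝ) {p : ℝ≥0∞}
    (hp : 1 ≤ p) : wNormPhase ω s F p < ∞ := by
  obtain ⟨a, b, hb⟩ := hω.gamma
  rcases eq_or_ne p ∞ with rfl | hpt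
  · obtain ⟨C, hC⟩ := h s
    refine eLpNormEssSup_lt_top_of_ae_bound (C := C) (.of_forall fun x => ?_)
    rw [norm_smul, Real.norm_of_nonneg (Real.exp_nonneg _)]
    exact hC x
  -- The surplus exponent `r` pays for integrability: `e^{-rω}` lies in `L^p` for every finite `p ≥
  -- 1`.
  · obtain ⟨r, hr⟩ := exists_gt (2 * (N : ℝ) / b)
    obtain ⟨C, hC⟩ := h (s + r)
    have hr0 : 0 ≤ r := (div_nonneg (by positivity) hb.1.le).trans hr.le
    have hp1 : 1 ≤ p.toReal := by simpa using ENNReal.toReal_mono hpt hp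
    have hfin : expNormPhase N ω r p < ∞ :=
      expNormPhase_lt_top hω hb (one_pos.trans_le hp).ne' hpt (hr.trans_le (by nlinarith))
    refine (eLpNorm_mono_real (g := fun z => C * Real.exp (-r * ω (phaseNorm z)))
      fun z => ?_).trans_lt (b := eLpNorm (C • fun z : RN N × RN N =>
        Real.exp (-r * ω (phaseNorm z))) p volume) ?_
    · rw [norm_smul, Real.norm_of_nonneg (Real.exp_nonneg _)]
      calc _ = Real.exp ((s + r) * ω (phaseNorm z)) * ‖F z‖ * Real.exp (-r * ω (phaseNorm z)) := by
            rw [mul_right_comm, ← Real.exp_add]; ring_nf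
        _ ≤ _ := by gcongr; exact hC z
    · rw [eLpNorm_const_smul]
      exact ENNReal.mul_lt_top enorm_lt_top hfin

/-- By `(α)`, `ω(z)` is controlled by `ω(x) + ω(ξ)`, which is at most twice the larger term. Decay
in each variable separately is therefore enough, at the price of the exponent `2K|s|`. -/
theorem exists_exp_phase_bound {N : ℕ} {ω : ℝ → ℝ} (hω : IsWeightFunction ω) {V : Type*}
    [NormedAddCommGroup V] {F : RN N × RN N → V}
    (h1 : ∀ s : ℝ, 0 ≤ s → ∃ C : ℝ, ∀ z, Real.exp (s * ω ‖z.1‖) * ‖F z‖ ≤ C)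
    (h2 : ∀ s : ℝ, 0 ≤ s → ∃ C : ℝ, ∀ z, Real.exp (s * ω ‖z.2‖) * ‖F z‖ ≤ C) (s : ℝ) :
    ∃ C : ℝ, ∀ z, Real.exp (s * ω (phaseNorm z)) * ‖F z‖ ≤ C := by
  obtain ⟨K, hK⟩ := hω.alpha
  have hK0 : 0 ≤ K := zero_le_one.trans hK.1
  obtain ⟨A, hA⟩ := h1 (2 * (K * |s|)) (by positivity)
  obtain ⟨B, hB⟩ := h2 (2 * (K * |s|)) (by positivity)
  refine ⟨Real.exp (|s| * K) * (A + B), fun z => ?_⟩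
  have hw := hω.phase_le hK z
  have hw0 := hω.nonneg _ (phaseNorm_nonneg z)
  have hA0 : 0 ≤ A := le_trans (by positivity) (hA z)
  have hB0 : 0 ≤ B := le_trans (by positivity) (hB z)
  calc Real.exp (s * ω (phaseNorm z)) * ‖F z‖
      ≤ Real.exp (|s| * K) * Real.exp (K * |s| * (ω ‖z.1‖ + ω ‖z.2‖)) * ‖F z‖ := by
        rw [← Real.exp_add]
        gcongr
        calc s * ω (phaseNorm z) ≤ |s| * ω (phaseNorm z) := by gcongr; exact le_abs_self s
          _ ≤ |s| * (K * (1 + (ω ‖z.1‖ + ω ‖z.2‖))) := by gcongr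
          _ = _ := by ring
    _ ≤ _ := by
        rw [mul_assoc]
        gcongr
        rcases le_total (ω ‖z.1‖) (ω ‖z.2‖) with h | h
        · refine le_trans ?_ ((hB z).trans (by linarith))
          refine mul_le_mul_of_nonneg_right (Real.exp_le_exp.2 ?_) (norm_nonneg _)
          nlinarith [mul_nonneg hK0 (abs_nonneg s)]
        · refine le_trans ?_ ((hA z).trans (by linarith))
          refine mul_le_mul_of_nonneg_right (Real.exp_le_exp.2 ?_) (norm_nonneg _)
          nlinarith [mul_nonneg hK0 (abs_nonneg s)]

/-! ### Cauchy–Schwarz along affine substitutions -/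

section Envelope

variable {N : ℕ} {ω : ℝ → ℝ}

/-- Cauchy–Schwarz through the pointwise inequality `2uv ≤ (q/p)u² + (p/q)v²`. Since both square
integrals are multiples of the same `I`, the optimal weights `p = √α`, `q = √β` are explicit. -/
theorem integral_mul_le_sqrt_mul {X : Type*} [MeasurableSpace X] {μ : Measure X} {u v : X → ℝ}
    {α β I : ℝ} (hα : 0 < α) (hβ : 0 < β) (hu : Integrable (fun x => u x ^ 2) μ)
    (hv : Integrable (fun x => v x ^ 2) μ) (huv : Integrable (fun x => u x * v x) μ)
    (hu2 : ∫ x, u x ^ 2 ∂μ = α * I) (hv2 : ∫ x, v x ^ 2 ∂μ = β * I) :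
    ∫ x, u x * v x ∂μ ≤ √(α * β) * I := by
  obtain ⟨p, hp, rfl⟩ : ∃ p : ℝ, 0 < p ∧ p ^ 2 = α := ⟨√α, Real.sqrt_pos.2 hα, Real.sq_sqrt hα.le⟩
  obtain ⟨q, hq, rfl⟩ : ∃ q : ℝ, 0 < q ∧ q ^ 2 = β := ⟨√β, Real.sqrt_pos.2 hβ, Real.sq_sqrt hβ.le⟩
  calc ∫ x, u x * v x ∂μ ≤ ∫ x, (q / p / 2 * u x ^ 2 + p / q / 2 * v x ^ 2) ∂μ := by
        refine integral_mono huv ((hu.const_mul _).add (hv.const_mul _)) fun x => ?_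
        have : q / p / 2 * u x ^ 2 + p / q / 2 * v x ^ 2 - u x * v x
            = (q * u x - p * v x) ^ 2 / (2 * p * q) := by
          field_simp
          ring
        have h2 : 0 ≤ (q * u x - p * v x) ^ 2 / (2 * p * q) := by positivity
        linarith
    _ = √(p ^ 2 * q ^ 2) * I := by
        rw [integral_add (hu.const_mul _) (hv.const_mul _), integral_const_mul, integral_const_mul,
          hu2, hv2, ← mul_pow, Real.sqrt_sq (by positivity)]
        field_simp
        ring

theorem integrable_comp_add_smul {E : Type*} [NormedAddCommGroup E] {F : RN N → E}
    (hF : Integrable F) (x₀ : RN N) {r : ℝ} (hr : r ≠ 0) :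
    Integrable fun t => F (x₀ + r • t) :=
  (hF.comp_add_left x₀).comp_smul hr

theorem integral_comp_add_smul {E : Type*} [NormedAddCommGroup E] [NormedSpace ℝ E]
    (F : RN N → E) (x₀ : RN N) (r : ℝ) :
    ∫ t, F (x₀ + r • t) = (|r| ^ N)⁻¹ • ∫ y, F y := by
  rw [Measure.integral_comp_smul volume (fun y => F (x₀ + y)) r, integral_add_left_eq_self,
    finrank_euclideanSpace_fin, abs_inv, abs_pow]

theorem HasExpDecay.integrable_mul_conj (hω : IsWeightFunction ω) {F₁ F₂ : RN N → ℂ}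
    (h₁ : HasExpDecay ω F₁) (h₂ : HasExpDecay ω F₂) (x₀ y₀ : RN N) {r₁ : ℝ} (r₂ : ℝ)
    (hr : r₁ ≠ 0) :
    Integrable fun t => F₁ (x₀ + r₁ • t) * (starRingEnd ℂ) (F₂ (y₀ + r₂ • t)) := by
  obtain ⟨C, hC⟩ := h₂.exists_norm_le
  refine (integrable_comp_add_smul (h₁.integrable hω) x₀ hr).mul_bdd (c := C) ?_ ?_
  · exact (Complex.continuous_conj.comp
      (h₂.continuous.comp (by fun_prop))).aestronglyMeasurable
  · exact .of_forall fun t => by simpa using hC _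

/-- The basic estimate for integrals of products of two functions bounded by a weight, along two
affine substitutions. -/
theorem integral_norm_mul_norm_le (hω : IsWeightFunction ω) {F₁ F₂ : RN N → ℂ} {σ m G₁ G₂ : ℝ}
    (hF₁ : ∀ y, ‖F₁ y‖ ≤ G₁ * Real.exp (-(σ + m) * ω ‖y‖))
    (hF₂ : ∀ y, ‖F₂ y‖ ≤ G₂ * Real.exp (-(σ + m) * ω ‖y‖))
    (hI : Integrable fun y : RN N => Real.exp (-(2 * m) * ω ‖y‖))
    (x₀ y₀ : RN N) {r₁ r₂ : ℝ} (hr₁ : r₁ ≠ 0) (hr₂ : r₂ ≠ 0) {c : ℝ}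
    (hc : ∀ t : RN N, c ≤ σ * (ω ‖x₀ + r₁ • t‖ + ω ‖y₀ + r₂ • t‖)) :
    ∫ t, ‖F₁ (x₀ + r₁ • t)‖ * ‖F₂ (y₀ + r₂ • t)‖ ≤
      G₁ * G₂ * Real.exp (-c) *
        ((√(|r₁ * r₂| ^ N))⁻¹ * ∫ y : RN N, Real.exp (-(2 * m) * ω ‖y‖)) := by
  have hG₁ : 0 ≤ G₁ := by
    have := (norm_nonneg _).trans (hF₁ 0)
    exact nonneg_of_mul_nonneg_left this (Real.exp_pos _)
  have hG₂ : 0 ≤ G₂ := by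
    have := (norm_nonneg _).trans (hF₂ 0)
    exact nonneg_of_mul_nonneg_left this (Real.exp_pos _)
  -- The decay `e^{-(σ+m)ω}` is split: the `σ` parts together supply `e^{-c}`, and the `m` parts,
  -- `E`, go through Cauchy–Schwarz. Each affine substitution contributes a Jacobian `|r|^{-N}`,
  -- whence the square root of `|r₁ r₂|^N`.
  set E : RN N → ℝ := fun y => Real.exp (-m * ω ‖y‖) with hE
  have hE2 : ∀ y, E y ^ 2 = Real.exp (-(2 * m) * ω ‖y‖) := fun y => by
    rw [hE, ← Real.exp_nat_mul]
    push_cast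
    ring_nf
  have hEc : Continuous E := Real.continuous_exp.comp (continuous_const.mul hω.continuous_norm)
  have hi : ∀ (z₀ : RN N) {r : ℝ}, r ≠ 0 → Integrable fun t : RN N => E (z₀ + r • t) ^ 2 :=
    fun z₀ r hr => by
      simp only [hE2]
      exact integrable_comp_add_smul hI z₀ hr
  have hv : ∀ (z₀ : RN N) (r : ℝ), ∫ t : RN N, E (z₀ + r • t) ^ 2 =
      (|r| ^ N)⁻¹ * ∫ y : RN N, Real.exp (-(2 * m) * ω ‖y‖) := fun z₀ r => by
    simp only [hE2]
    exact integral_comp_add_smul (fun y : RN N => Real.exp (-(2 * m) * ω ‖y‖)) z₀ r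
  have hprod : Integrable fun t : RN N => E (x₀ + r₁ • t) * E (y₀ + r₂ • t) := by
    refine ((hi x₀ hr₁).add (hi y₀ hr₂)).mono' ?_ (.of_forall fun t => ?_)
    · exact Continuous.aestronglyMeasurable
        ((hEc.comp (by fun_prop)).mul (hEc.comp (by fun_prop)))
    · rw [Real.norm_of_nonneg (by positivity)]
      simp only [Pi.add_apply]
      nlinarith [sq_nonneg (E (x₀ + r₁ • t) - E (y₀ + r₂ • t)), sq_nonneg (E (x₀ + r₁ • t)),
        sq_nonneg (E (y₀ + r₂ • t))]
  have key := integral_mul_le_sqrt_mul (by positivity) (by positivity) (hi x₀ hr₁) (hi y₀ hr₂)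
    hprod (hv x₀ r₁) (hv y₀ r₂)
  calc ∫ t, ‖F₁ (x₀ + r₁ • t)‖ * ‖F₂ (y₀ + r₂ • t)‖
      ≤ ∫ t, G₁ * G₂ * Real.exp (-c) * (E (x₀ + r₁ • t) * E (y₀ + r₂ • t)) := by
        refine integral_mono_of_nonneg (.of_forall fun t => by positivity)
          (hprod.const_mul _) (.of_forall fun t => ?_)
        calc ‖F₁ (x₀ + r₁ • t)‖ * ‖F₂ (y₀ + r₂ • t)‖
            ≤ (G₁ * Real.exp (-(σ + m) * ω ‖x₀ + r₁ • t‖)) *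
              (G₂ * Real.exp (-(σ + m) * ω ‖y₀ + r₂ • t‖)) := by
              gcongr
              · exact hF₁ _
              · exact hF₂ _
          _ = G₁ * G₂ * Real.exp (-(σ * (ω ‖x₀ + r₁ • t‖ + ω ‖y₀ + r₂ • t‖))) *
              (E (x₀ + r₁ • t) * E (y₀ + r₂ • t)) := by
              rw [hE, mul_mul_mul_comm, ← Real.exp_add, mul_assoc (G₁ * G₂), ← Real.exp_add,
                ← Real.exp_add]
              ring_nf
          _ ≤ _ := mul_le_mul_of_nonneg_right (mul_le_mul_of_nonneg_left
              (Real.exp_le_exp.2 (neg_le_neg (hc t))) (by positivity)) (by positivity)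
    _ = G₁ * G₂ * Real.exp (-c) * ∫ t, E (x₀ + r₁ • t) * E (y₀ + r₂ • t) :=
        integral_const_mul _ _
    _ ≤ _ := by
        gcongr
        refine key.trans_eq ?_
        rw [← mul_inv, ← mul_pow, ← abs_mul, Real.sqrt_inv]

end Envelope

/-! ### Parseval's formula for the unnormalized Fourier transform -/

section Fourier

variable {N : ℕ}

theorem norm_exp_neg_I_mul (r : ℝ) : ‖Complex.exp (-(Complex.I * (r : ℂ)))‖ = 1 := by
  rw [Complex.norm_exp]
  simp

theorem fourier_eq_fourierHat (f : RN N → ℂ) (w : RN N) :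
    FourierTransform.fourier f w = fourierHat f ((2 * Real.pi) • w) := by
  rw [Real.fourier_eq', fourierHat]
  refine integral_congr_ae (.of_forall fun v => ?_)
  simp only [smul_eq_mul, inner_smul_right]
  congr 2
  push_cast
  ring

/-- Fourier inversion writes `f(-t)` as a double Fourier transform, and the multiplication formula
then moves one transform onto the other factor. The constant is the Jacobian of the rescaling by
`2π` between the two normalizations. -/
theorem integral_mul_eq_integral_fourierHat {f h : RN N → ℂ} (hf : Continuous f)
    (hfi : Integrable f) (hfh : Integrable (fourierHat f)) (hh : Integrable h) :
    ∫ t, f t * h t = (((2 * Real.pi) ^ N)⁻¹ : ℝ) * ∫ η, fourierHat f η * fourierHat h (-η) := by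
  have hpi : (2 * Real.pi) ≠ 0 := by positivity
  have hFi : Integrable (FourierTransform.fourier f) := by
    have : FourierTransform.fourier f = fun w => fourierHat f ((2 * Real.pi) • w) :=
      funext (fourier_eq_fourierHat f)
    rw [this]
    exact hfh.comp_smul hpi
  have hinv : ∀ t, f (-t) = FourierTransform.fourier (FourierTransform.fourier f) t := fun t => by
    rw [← hfi.fourierInv_fourier_eq hFi hf.continuousAt, Real.fourierInv_eq_fourier_neg, neg_neg]
  have hh' : Integrable fun t => h (-t) := hh.comp_neg
  calc ∫ t, f t * h t = ∫ t, f (-t) * h (-t) := (integral_neg_eq_self _ _).symm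
    _ = ∫ t, FourierTransform.fourier (FourierTransform.fourier f) t * h (-t) := by
        simp only [hinv]
    _ = ∫ w, FourierTransform.fourier f w * FourierTransform.fourier (fun t => h (-t)) w := by
        have := VectorFourier.integral_fourierIntegral_smul_eq_flip (L := innerₗ (RN N))
          Real.continuous_fourierChar continuous_inner hFi hh'
        rwa [flip_innerₗ] at this
    _ = ∫ w, (fun η => fourierHat f η * fourierHat h (-η)) ((2 * Real.pi) • w) := by
        simp only [fourier_eq_fourierHat, fourierHat_comp_neg]
    _ = _ := by
        rw [Measure.integral_comp_smul volume (fun η => fourierHat f η * fourierHat h (-η)),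
          finrank_euclideanSpace_fin, abs_of_pos (by positivity), Complex.real_smul]

theorem fourierHat_conj_modulate (φ : RN N → ℂ) (ξ η : RN N) :
    fourierHat (fun t => (starRingEnd ℂ) (φ t) *
      Complex.exp (-(Complex.I * ((inner ℝ t ξ : ℝ) : ℂ)))) (-η) =
      (starRingEnd ℂ) (fourierHat φ (η - ξ)) := by
  unfold fourierHat
  rw [← integral_conj]
  refine integral_congr_ae (.of_forall fun t => ?_)
  simp only [map_mul, ← Complex.exp_conj, map_neg, Complex.conj_I, Complex.conj_ofReal]
  rw [mul_comm, mul_assoc, ← Complex.exp_add, mul_comm]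
  congr 2
  rw [inner_neg_right, inner_sub_right]
  push_cast
  ring

/-- Parseval's formula with a modulation. -/
theorem integral_mul_conj_modulate {φ₁ φ₂ : RN N → ℂ} (hc : Continuous φ₁)
    (h₁ : Integrable φ₁) (h₁' : Integrable (fourierHat φ₁)) (h₂ : Integrable φ₂) (ξ : RN N) :
    ∫ t, φ₁ t * ((starRingEnd ℂ) (φ₂ t) *
      Complex.exp (-(Complex.I * ((inner ℝ t ξ : ℝ) : ℂ)))) =
      (((2 * Real.pi) ^ N)⁻¹ : ℝ) * ∫ η, fourierHat φ₁ η * (starRingEnd ℂ) (fourierHat φ₂ (η - ξ)) := by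
  rw [integral_mul_eq_integral_fourierHat hc h₁ h₁']
  · simp only [fourierHat_conj_modulate]
  · refine ((LinearIsometryEquiv.integrable_comp_iff Complex.conjLIE).2 h₂).mul_bdd (c := 1) ?_ ?_
    · exact Continuous.aestronglyMeasurable (by fun_prop)
    · exact .of_forall fun t => (norm_exp_neg_I_mul _).le

theorem norm_integral_mul_conj_modulate_le {φ₁ φ₂ : RN N → ℂ} (hc : Continuous φ₁)
    (h₁ : Integrable φ₁) (h₁' : Integrable (fourierHat φ₁)) (h₂ : Integrable φ₂) (ξ : RN N) :
    ‖∫ t, φ₁ t * ((starRingEnd ℂ) (φ₂ t) *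
      Complex.exp (-(Complex.I * ((inner ℝ t ξ : ℝ) : ℂ))))‖ ≤
      ((2 * Real.pi) ^ N)⁻¹ * ∫ η, ‖fourierHat φ₁ η‖ * ‖fourierHat φ₂ (η - ξ)‖ := by
  rw [integral_mul_conj_modulate hc h₁ h₁' h₂, norm_mul]
  rw [Complex.norm_real, Real.norm_of_nonneg (by positivity)]
  gcongr
  refine (norm_integral_le_integral_norm _).trans_eq ?_
  simp

/-- The translation by `x₀` contributes only a unimodular phase, so after taking norms only the
dilation is visible. -/
theorem norm_fourierHat_comp_add_smul (f : RN N → ℂ) (x₀ : RN N) {r : ℝ} (hr : r ≠ 0)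
    (η : RN N) :
    ‖fourierHat (fun t => f (x₀ + r • t)) η‖ = (|r| ^ N)⁻¹ * ‖fourierHat f (r⁻¹ • η)‖ := by
  have : fourierHat (fun t => f (x₀ + r • t)) η =
      (|r| ^ N)⁻¹ • (Complex.exp (-(Complex.I * ((-inner ℝ x₀ (r⁻¹ • η) : ℝ) : ℂ))) *
        fourierHat f (r⁻¹ • η)) := by
    unfold fourierHat
    rw [← integral_const_mul, ← integral_comp_add_smul _ x₀ r]
    refine integral_congr_ae (.of_forall fun t => ?_)
    simp only
    rw [← mul_assoc, ← Complex.exp_add]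
    congr 2
    rw [inner_add_left, inner_smul_left, inner_smul_right, inner_smul_right]
    simp only [conj_trivial]
    rw [mul_inv_cancel_left₀ hr]
    push_cast
    ring
  rw [this, norm_smul, norm_mul, norm_exp_neg_I_mul, one_mul,
    Real.norm_of_nonneg (by positivity)]

end Fourier

/-! ### Decay of the Wigner transform and of the short-time Fourier transform -/

section Transforms

variable {N : ℕ} {ω : ℝ → ℝ} {f g : RN N → ℂ} {τ : ℝ}

theorem continuous_fourierHat (hf : Integrable f) : Continuous (fourierHat f) := by
  have h : fourierHat f = fun ξ => FourierTransform.fourier f ((2 * Real.pi)⁻¹ • ξ) := by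
    ext ξ
    rw [fourier_eq_fourierHat, smul_smul, mul_inv_cancel₀ (by positivity), one_smul]
  rw [h]
  exact (VectorFourier.fourierIntegral_continuous Real.continuous_fourierChar
    (L := innerₗ (RN N)) continuous_inner hf).comp (continuous_const_smul _)

theorem integrable_fourierHat_comp_add_smul (hf : Integrable f)
    (hf' : Integrable (fourierHat f)) (x₀ : RN N) {r : ℝ} (hr : r ≠ 0) :
    Integrable (fourierHat fun t => f (x₀ + r • t)) := by
  rw [← integrable_norm_iff
    (continuous_fourierHat (integrable_comp_add_smul hf x₀ hr)).aestronglyMeasurable]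
  simp only [norm_fourierHat_comp_add_smul f x₀ hr]
  exact (hf'.comp_smul (inv_ne_zero hr)).norm.const_mul _

/-- The polarized `τ`-Wigner transform. -/
noncomputable def crossWig (τ : ℝ) (f h : RN N → ℂ) (z : RN N × RN N) : ℂ :=
  ∫ t : RN N, Complex.exp (-(Complex.I * ((inner ℝ t z.2 : ℝ) : ℂ))) *
    f (z.1 + τ • t) * (starRingEnd ℂ) (h (z.1 - (1 - τ) • t))

theorem wig_eq_crossWig (τ : ℝ) (f : RN N → ℂ) : wig τ f = crossWig τ f f := rfl

theorem wig_eq_integral_modulate (τ : ℝ) (f : RN N → ℂ) (z : RN N × RN N) :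
    wig τ f z = ∫ t, f (z.1 + τ • t) * ((starRingEnd ℂ) (f (z.1 + (-(1 - τ)) • t)) *
      Complex.exp (-(Complex.I * ((inner ℝ t z.2 : ℝ) : ℂ)))) := by
  unfold wig
  congr 1
  ext t
  rw [neg_smul, ← sub_eq_add_neg]
  ring

theorem norm_wig_le_integral (τ : ℝ) (f : RN N → ℂ) (z : RN N × RN N) :
    ‖wig τ f z‖ ≤ ∫ t, ‖f (z.1 + τ • t)‖ * ‖f (z.1 + (-(1 - τ)) • t)‖ := by
  rw [wig_eq_integral_modulate]
  refine (norm_integral_le_integral_norm _).trans_eq ?_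
  simp only [norm_mul, norm_exp_neg_I_mul, RCLike.norm_conj, mul_one]

/-- Parseval in `t` for the two dilated and translated copies of `f`. The first point `x` disappears
into phases, which is what makes decay in `ξ` accessible. -/
theorem norm_wig_le_integral_fourierHat (hτ0 : 0 < τ) (hτ1 : τ < 1) (hc : Continuous f)
    (hf : Integrable f) (hf' : Integrable (fourierHat f)) (z : RN N × RN N) :
    ‖wig τ f z‖ ≤ ((2 * Real.pi) ^ N)⁻¹ * (((τ - τ ^ 2) ^ N)⁻¹ *
      ∫ η, ‖fourierHat f (0 + τ⁻¹ • η)‖ *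
        ‖fourierHat f ((1 - τ)⁻¹ • z.2 + (-(1 - τ)⁻¹) • η)‖) := by
  have h1 : (-(1 - τ)) ≠ 0 := by linarith
  rw [wig_eq_integral_modulate]
  refine (norm_integral_mul_conj_modulate_le (φ₁ := fun t => f (z.1 + τ • t))
    (φ₂ := fun t => f (z.1 + (-(1 - τ)) • t)) (hc.comp (by fun_prop))
    (integrable_comp_add_smul hf _ hτ0.ne') (integrable_fourierHat_comp_add_smul hf hf' _ hτ0.ne')
    (integrable_comp_add_smul hf _ h1) z.2).trans_eq ?_
  simp only [norm_fourierHat_comp_add_smul f _ hτ0.ne', norm_fourierHat_comp_add_smul f _ h1]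
  rw [← integral_const_mul ((τ - τ ^ 2) ^ N)⁻¹]
  congr 1
  refine integral_congr_ae (.of_forall fun η => ?_)
  beta_reduce
  have e1 : (-(1 - τ))⁻¹ • (η - z.2) = (1 - τ)⁻¹ • z.2 + (-(1 - τ)⁻¹) • η := by
    rw [inv_neg, smul_sub, neg_smul, neg_smul]
    abel
  rw [e1, zero_add, abs_neg, abs_of_pos hτ0, abs_of_pos (by linarith : 0 < 1 - τ), mul_mul_mul_comm,
    ← mul_inv, ← mul_pow]
  ring_nf

theorem convexComb_norm_le_max {u v : RN N} (hτ0 : 0 < τ) (hτ1 : τ < 1) :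
    ‖(1 - τ) • u + τ • v‖ ≤ max ‖u‖ ‖v‖ := by
  refine (norm_add_le _ _).trans ?_
  rw [norm_smul, norm_smul, Real.norm_of_nonneg (by linarith), Real.norm_of_nonneg hτ0.le]
  nlinarith [le_max_left ‖u‖ ‖v‖, le_max_right ‖u‖ ‖v‖]

/-- Pointwise decay of the Wigner transform, with explicit constant. -/
theorem norm_wig_le (hω : IsWeightFunction ω) (hτ0 : 0 < τ) (hτ1 : τ < 1)
    (hf : HasExpDecay ω f) (hf' : HasExpDecay ω (fourierHat f)) {σ m A B : ℝ} (hσ : 0 ≤ σ)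
    (hA : ∀ y, Real.exp ((σ + m) * ω ‖y‖) * ‖f y‖ ≤ A)
    (hB : ∀ y, Real.exp ((σ + m) * ω ‖y‖) * ‖fourierHat f y‖ ≤ B)
    (hI : Integrable fun y : RN N => Real.exp (-(2 * m) * ω ‖y‖)) (z : RN N × RN N) :
    ‖wig τ f z‖ ≤ (√((2 * Real.pi) ^ N))⁻¹ * (√((τ - τ ^ 2) ^ N))⁻¹ * (A * B) *
      (∫ y : RN N, Real.exp (-(2 * m) * ω ‖y‖)) *
      Real.exp (-(σ / 2) * (ω ‖z.1‖ + ω ‖z.2‖)) := by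
  have h1τ : 0 < 1 - τ := by linarith
  have hd : 0 < τ - τ ^ 2 := by nlinarith
  have hA0 : 0 ≤ A := le_trans (by positivity) (hA 0)
  have hB0 : 0 ≤ B := le_trans (by positivity) (hB 0)
  set I := ∫ y : RN N, Real.exp (-(2 * m) * ω ‖y‖) with hIdef
  have hI0 : 0 ≤ I := integral_nonneg fun _ => (Real.exp_pos _).le
  have hA' := fun y => norm_le_exp_neg_mul (hA y)
  have hB' := fun y => norm_le_exp_neg_mul (hB y)
  -- The point at which decay is wanted is always a convex combination, with weights `τ` and `1 -
  -- τ`, of the two arguments of the integrand, so one of them is at least as large in norm. This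
  -- covers both the time side and the frequency side without using `(α)`.
  have key : ∀ (x₀ y₀ x : RN N) (r₁ r₂ : ℝ), (∀ t, x = (1 - τ) • (x₀ + r₁ • t) + τ • (y₀ + r₂ • t)
      ∨ x = τ • (x₀ + r₁ • t) + (1 - τ) • (y₀ + r₂ • t)) →
      ∀ t : RN N, σ * ω ‖x‖ ≤ σ * (ω ‖x₀ + r₁ • t‖ + ω ‖y₀ + r₂ • t‖) := by
    intro x₀ y₀ x r₁ r₂ h t
    refine mul_le_mul_of_nonneg_left (hω.le_add_of_le_max (norm_nonneg _) (norm_nonneg _)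
      (norm_nonneg _) ?_) hσ
    rcases h t with h | h
    · conv_lhs => rw [h]
      exact convexComb_norm_le_max hτ0 hτ1
    · conv_lhs => rw [h, add_comm]
      rw [max_comm]
      exact convexComb_norm_le_max hτ0 hτ1
  have hP := (norm_wig_le_integral τ f z).trans
    (integral_norm_mul_norm_le hω hA' hA' hI z.1 z.1 hτ0.ne' (neg_ne_zero.2 h1τ.ne')
      (key z.1 z.1 z.1 τ (-(1 - τ)) fun t => Or.inl (by module)))
  have hQ := (norm_wig_le_integral_fourierHat hτ0 hτ1 hf.continuous (hf.integrable hω)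
    (hf'.integrable hω) z).trans (mul_le_mul_of_nonneg_left (mul_le_mul_of_nonneg_left
      (integral_norm_mul_norm_le hω hB' hB' hI 0 ((1 - τ)⁻¹ • z.2) (inv_ne_zero hτ0.ne')
      (neg_ne_zero.2 (inv_ne_zero h1τ.ne'))
      (key 0 _ z.2 τ⁻¹ (-(1 - τ)⁻¹) fun t => Or.inr (by
        match_scalars
        · field_simp
        · field_simp
          ring))) (by positivity)) (by positivity))
  have e1 : |τ * -(1 - τ)| = τ - τ ^ 2 := by
    rw [mul_neg, abs_neg, abs_of_pos (by positivity)]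
    ring
  have e2 : |τ⁻¹ * -(1 - τ)⁻¹| = (τ - τ ^ 2)⁻¹ := by
    rw [mul_neg, abs_neg, ← mul_inv, abs_of_pos (by positivity)]
    ring_nf
  rw [e1, ← hIdef] at hP
  rw [e2, ← hIdef, inv_pow, Real.sqrt_inv, inv_inv] at hQ
  -- Geometric mean: the square of the norm is bounded by the product of the time bound `hP` and the
  -- frequency bound `hQ`. This halves the exponent `σ` and the power of `2π`, and leaves `(τ -
  -- τ²)^{-N/2}`.
  refine (pow_le_pow_iff_left₀ (norm_nonneg _) (by positivity) two_ne_zero).1 ?_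
  rw [sq]
  refine (mul_le_mul hP hQ (norm_nonneg _) (by positivity)).trans_eq ?_
  set D := √((τ - τ ^ 2) ^ N) with hD
  set P := √((2 * Real.pi) ^ N) with hPd
  have hD0 : 0 < D := Real.sqrt_pos.2 (by positivity)
  have hP0 : 0 < P := Real.sqrt_pos.2 (by positivity)
  have eD : (τ - τ ^ 2) ^ N = D ^ 2 := (Real.sq_sqrt (by positivity)).symm
  have eP : (2 * Real.pi) ^ N = P ^ 2 := (Real.sq_sqrt (by positivity)).symm
  have eE : Real.exp (-(σ / 2) * (ω ‖z.1‖ + ω ‖z.2‖)) ^ 2 =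
      Real.exp (-(σ * ω ‖z.1‖)) * Real.exp (-(σ * ω ‖z.2‖)) := by
    rw [← Real.exp_nat_mul, ← Real.exp_add]
    push_cast
    ring_nf
  rw [mul_pow _ (Real.exp _), eE, eD, eP]
  field_simp

theorem exists_integrable_exp_neg (hω : IsWeightFunction ω) (N : ℕ) :
    ∃ m : ℝ, Integrable fun y : RN N => Real.exp (-(2 * m) * ω ‖y‖) := by
  obtain ⟨a, b, hb⟩ := hω.gamma
  obtain ⟨s, hs⟩ := exists_gt ((N : ℝ) / b)
  refine ⟨s / 2, ?_⟩
  rw [mul_div_cancel₀ _ two_ne_zero]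
  exact hω.integrable_exp_neg hb hs

theorem exists_exp_mul_norm_wig_le (hω : IsWeightFunction ω) (hτ0 : 0 < τ) (hτ1 : τ < 1)
    (hf : HasExpDecay ω f) (hf' : HasExpDecay ω (fourierHat f)) (s : ℝ) :
    ∃ C : ℝ, ∀ z, Real.exp (s * ω (phaseNorm z)) * ‖wig τ f z‖ ≤ C := by
  obtain ⟨m, hI⟩ := exists_integrable_exp_neg hω N
  have main : ∀ s : ℝ, 0 ≤ s → ∃ C : ℝ, ∀ z : RN N × RN N,
      Real.exp (s * (ω ‖z.1‖ + ω ‖z.2‖)) * ‖wig τ f z‖ ≤ C := by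
    intro s hs
    obtain ⟨A, hA⟩ := hf.bound (2 * s + m)
    obtain ⟨B, hB⟩ := hf'.bound (2 * s + m)
    refine ⟨_, fun z => (mul_le_mul_of_nonneg_left
      (norm_wig_le hω hτ0 hτ1 hf hf' (by positivity) hA hB hI z) (Real.exp_nonneg _)).trans_eq
      (c := (√((2 * Real.pi) ^ N))⁻¹ * (√((τ - τ ^ 2) ^ N))⁻¹ * (A * B) *
        (∫ y : RN N, Real.exp (-(2 * m) * ω ‖y‖))) ?_⟩
    rw [mul_left_comm, ← Real.exp_add, mul_div_cancel_left₀ _ two_ne_zero, neg_mul,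
      add_neg_cancel, Real.exp_zero, mul_one]
  refine exists_exp_phase_bound hω (fun s hs => ?_) (fun s hs => ?_) s
  all_goals
    obtain ⟨C, hC⟩ := main s hs
    refine ⟨C, fun z => le_trans ?_ (hC z)⟩
    have h1 := hω.nonneg _ (norm_nonneg z.1)
    have h2 := hω.nonneg _ (norm_nonneg z.2)
    gcongr
    linarith

theorem stronglyMeasurable_wig (hf : Continuous f) : StronglyMeasurable (wig τ f) := by
  refine StronglyMeasurable.integral_prod_right (f := fun (z : RN N × RN N) (t : RN N) =>
    Complex.exp (-(Complex.I * ((inner ℝ t z.2 : ℝ) : ℂ))) *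
      f (z.1 + τ • t) * (starRingEnd ℂ) (f (z.1 - (1 - τ) • t))) (Continuous.stronglyMeasurable ?_)
  simp only [Function.uncurry_def]
  fun_prop

theorem stronglyMeasurable_stft (hf : Continuous f) (hg : Continuous g) :
    StronglyMeasurable (stft g f) := by
  refine StronglyMeasurable.integral_prod_right (f := fun (z : RN N × RN N) (y : RN N) =>
    f y * (starRingEnd ℂ) (g (y - z.1)) *
      Complex.exp (-(Complex.I * ((inner ℝ y z.2 : ℝ) : ℂ)))) (Continuous.stronglyMeasurable ?_)
  simp only [Function.uncurry_def]
  fun_prop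

theorem stft_eq_integral_modulate (g f : RN N → ℂ) (z : RN N × RN N) :
    stft g f z = ∫ y, f y * ((starRingEnd ℂ) (g (-z.1 + (1 : ℝ) • y)) *
      Complex.exp (-(Complex.I * ((inner ℝ y z.2 : ℝ) : ℂ)))) := by
  unfold stft
  congr 1
  ext y
  rw [one_smul, neg_add_eq_sub, mul_assoc]

theorem norm_stft_le_integral (g f : RN N → ℂ) (z : RN N × RN N) :
    ‖stft g f z‖ ≤ ∫ y, ‖f (0 + (1 : ℝ) • y)‖ * ‖g (-z.1 + (1 : ℝ) • y)‖ := by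
  rw [stft_eq_integral_modulate]
  refine (norm_integral_le_integral_norm _).trans_eq ?_
  simp only [norm_mul, norm_exp_neg_I_mul, RCLike.norm_conj, mul_one, one_smul, zero_add]

theorem norm_stft_le_integral_fourierHat (hc : Continuous f) (hf : Integrable f)
    (hf' : Integrable (fourierHat f)) (hg : Integrable g) (z : RN N × RN N) :
    ‖stft g f z‖ ≤ ((2 * Real.pi) ^ N)⁻¹ *
      ∫ η, ‖fourierHat f (0 + (1 : ℝ) • η)‖ * ‖fourierHat g (-z.2 + (1 : ℝ) • η)‖ := by
  rw [stft_eq_integral_modulate]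
  refine (norm_integral_mul_conj_modulate_le (φ₂ := fun y => g (-z.1 + (1 : ℝ) • y)) hc hf hf'
    (integrable_comp_add_smul hg _ one_ne_zero) z.2).trans_eq ?_
  simp only [norm_fourierHat_comp_add_smul g _ one_ne_zero]
  simp [neg_add_eq_sub]

/-- Since `x = y - (y - x)`, `(α)` gives `ω(x) ≤ K(1 + ω(y) + ω(y - x))`, so decay of both factors
passes to the correlation. Applied to `f, g` this gives decay of `V_g f` in time, and to `f̂, ĝ`
decay in frequency. -/
theorem exists_exp_mul_integral_le (hω : IsWeightFunction ω) {F G : RN N → ℂ}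
    (hF : HasExpDecay ω F) (hG : HasExpDecay ω G) {s : ℝ} (hs : 0 ≤ s) :
    ∃ C : ℝ, ∀ x, Real.exp (s * ω ‖x‖) *
      ∫ y, ‖F (0 + (1 : ℝ) • y)‖ * ‖G (-x + (1 : ℝ) • y)‖ ≤ C := by
  obtain ⟨K, hK⟩ := hω.alpha
  have hK0 : 0 ≤ K := zero_le_one.trans hK.1
  obtain ⟨m, hI⟩ := exists_integrable_exp_neg hω N
  obtain ⟨A, hA⟩ := hF.bound (K * s + m)
  obtain ⟨B, hB⟩ := hG.bound (K * s + m)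
  refine ⟨_, fun x => (mul_le_mul_of_nonneg_left
    (integral_norm_mul_norm_le hω (c := s * ω ‖x‖ - K * s) (fun y => norm_le_exp_neg_mul (hA y))
      (fun y => norm_le_exp_neg_mul (hB y)) hI 0 (-x) one_ne_zero one_ne_zero fun t => ?_)
      (Real.exp_nonneg _)).trans_eq (c := A * B * Real.exp (K * s) *
        ((√(|(1 : ℝ) * 1| ^ N))⁻¹ * ∫ y : RN N, Real.exp (-(2 * m) * ω ‖y‖))) ?_⟩
  · have h : ‖x‖ ≤ ‖0 + (1 : ℝ) • t‖ + ‖-x + (1 : ℝ) • t‖ := by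
      rw [← norm_neg (-x + _)]
      refine le_trans (le_of_eq ?_) (norm_add_le _ _)
      congr 1
      module
    have := hω.le_of_le_add hK (norm_nonneg _) (norm_nonneg _) (norm_nonneg _) h
    nlinarith
  · rw [neg_sub, Real.exp_sub]
    field_simp

theorem exists_exp_mul_norm_stft_le (hω : IsWeightFunction ω)
    (hf : HasExpDecay ω f) (hf' : HasExpDecay ω (fourierHat f))
    (hg : HasExpDecay ω g) (hg' : HasExpDecay ω (fourierHat g)) (s : ℝ) :
    ∃ C : ℝ, ∀ z, Real.exp (s * ω (phaseNorm z)) * ‖stft g f z‖ ≤ C := by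
  refine exists_exp_phase_bound hω (fun s hs => ?_) (fun s hs => ?_) s
  · obtain ⟨C, hC⟩ := exists_exp_mul_integral_le hω hf hg hs
    exact ⟨C, fun z => (mul_le_mul_of_nonneg_left (norm_stft_le_integral g f z)
      (Real.exp_nonneg _)).trans (hC z.1)⟩
  · obtain ⟨C, hC⟩ := exists_exp_mul_integral_le hω hf' hg' hs
    refine ⟨((2 * Real.pi) ^ N)⁻¹ * C, fun z => (mul_le_mul_of_nonneg_left
      (norm_stft_le_integral_fourierHat hf.continuous (hf.integrable hω) (hf'.integrable hω)
        (hg.integrable hω) z) (Real.exp_nonneg _)).trans ?_⟩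
    rw [mul_left_comm]
    exact mul_le_mul_of_nonneg_left (hC z.2) (by positivity)

theorem exists_exp_mul_norm_spectrogram_le (hω : IsWeightFunction ω)
    (hf : HasExpDecay ω f) (hf' : HasExpDecay ω (fourierHat f))
    (hg : HasExpDecay ω g) (hg' : HasExpDecay ω (fourierHat g)) (s : ℝ) :
    ∃ C : ℝ, ∀ z, Real.exp (s * ω (phaseNorm z)) * ‖spectrogram g f z‖ ≤ C := by
  obtain ⟨C, hC⟩ := exists_exp_mul_norm_stft_le hω hf hf' hg hg' (s / 2)
  refine ⟨C ^ 2, fun z => ?_⟩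
  refine le_trans (le_of_eq ?_) (pow_le_pow_left₀ (by positivity) (hC z) 2)
  rw [spectrogram, norm_pow, norm_norm, mul_pow, ← Real.exp_nat_mul]
  push_cast
  ring_nf

end Transforms

/-! ### The spectrogram bounded by the Wigner transform -/

instance instIsNegInvariantPhase {N : ℕ} :
    (volume : Measure (RN N × RN N)).IsNegInvariant :=
  Measure.IsAddHaarMeasure.isNegInvariant_of_regular _

section Spectrogram

variable {N : ℕ} {ω : ℝ → ℝ} {f g : RN N → ℂ} {τ : ℝ}

theorem lintegral_enorm_mul_enorm_le {X : Type*} [MeasurableSpace X] {μ : Measure X}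
    {𝕜 E : Type*} [NormedField 𝕜] [NormedAddCommGroup E] [NormedSpace 𝕜 E] {u : X → 𝕜} {v : X → E}
    (hu : AEStronglyMeasurable u μ) (hv : AEStronglyMeasurable v μ) {p q : ℝ≥0∞}
    (hpq : p.HolderConjugate q) :
    ∫⁻ x, ‖u x‖ₑ * ‖v x‖ₑ ∂μ ≤ eLpNorm u p μ * eLpNorm v q μ := by
  have := eLpNorm_smul_le_mul_eLpNorm (p := p) (q := q) (r := 1) hv hu
  rw [eLpNorm_one_eq_lintegral_enorm] at this
  simpa [enorm_smul] using this

/-- The linear map has determinant of absolute value one: it is the coordinate swap followed by two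
shears. -/
theorem measurePreserving_wigner_coordinates (τ : ℝ) :
    MeasurePreserving (fun q : RN N × RN N => (q.1 + τ • q.2, q.1 + (-(1 - τ)) • q.2)) := by
  have h1 : MeasurePreserving (Prod.swap : RN N × RN N → RN N × RN N) :=
    Measure.measurePreserving_swap
  have h2 : MeasurePreserving (fun q : RN N × RN N => (q.1, q.2 + (-(1 - τ)) • q.1)) := by
    refine MeasurePreserving.skew_product (MeasurePreserving.id _)
      (g := fun t y => y + (-(1 - τ)) • t) (Continuous.measurable ?_) (.of_forall fun t => ?_)
    · simp only [Function.uncurry_def]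
      fun_prop
    · exact (measurePreserving_add_right volume _).map_eq
  have h3 : MeasurePreserving (fun q : RN N × RN N => (q.1 + q.2, q.2)) :=
    measurePreserving_add_prod volume volume
  convert h3.comp (h2.comp h1) using 1
  ext q : 1
  simp only [Function.comp, Prod.swap, Prod.mk.injEq, and_true]
  module

theorem fourierHat_mul_conj_eq_wig (τ : ℝ) (f : RN N → ℂ) (y η : RN N) :
    fourierHat (fun t => f (y + τ • t) * (starRingEnd ℂ) (f (y + (-(1 - τ)) • t))) η =
      wig τ f (y, η) := by
  rw [wig_eq_integral_modulate, fourierHat]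
  congr 1
  ext t
  ring

/-- Complex conjugation exchanges the two factors of the integrand, turning `τ` into `1 - τ`; the
reflection of the window accounts for the sign of the argument. -/
theorem enorm_wig_reflect (τ : ℝ) (g : RN N → ℂ) (w : RN N × RN N) :
    ‖wig (1 - τ) (fun t => g (-t)) w‖ₑ = ‖wig τ g (-w)‖ₑ := by
  rw [← RCLike.enorm_conj (wig τ g (-w))]
  congr 1
  unfold wig
  rw [← integral_conj]
  congr 1
  ext t
  simp only [map_mul, ← Complex.exp_conj, map_neg, Complex.conj_I, Complex.conj_ofReal,
    Complex.conj_conj, Prod.fst_neg, Prod.snd_neg, inner_neg_right]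
  rw [mul_right_comm]
  congr 3
  · push_cast
    ring_nf
  · congr 1
    module
  · module

theorem integrable_wig_right (hω : IsWeightFunction ω) (hτ0 : 0 < τ) (hτ1 : τ < 1)
    (hf : HasExpDecay ω f) (hf' : HasExpDecay ω (fourierHat f)) (y : RN N) :
    Integrable fun η => wig τ f (y, η) := by
  refine HasExpDecay.integrable hω (.of_pos hω ?_ fun s hs => ?_)
  · simp only [← fourierHat_mul_conj_eq_wig]
    exact continuous_fourierHat (hf.integrable_mul_conj hω hf y y _ hτ0.ne')
  · obtain ⟨C, hC⟩ := exists_exp_mul_norm_wig_le hω hτ0 hτ1 hf hf' s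
    refine ⟨C, fun η => le_trans ?_ (hC (y, η))⟩
    gcongr
    exact hω.monotoneOn (norm_nonneg η) (phaseNorm_nonneg _) (norm_snd_le_phaseNorm (y, η))

/-- The spectrogram is dominated by the convolution of the Wigner transforms of `f` and of the
reflected window. -/
theorem enorm_spectrogram_le (hω : IsWeightFunction ω) (hτ0 : 0 < τ) (hτ1 : τ < 1)
    (hf : HasExpDecay ω f) (hf' : HasExpDecay ω (fourierHat f)) (hg : HasExpDecay ω g)
    (z : RN N × RN N) :
    ‖spectrogram g f z‖ₑ ≤ ∫⁻ w, ‖wig τ f w‖ₑ * ‖wig (1 - τ) (fun t => g (-t)) (z - w)‖ₑ := by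
  simp only [enorm_wig_reflect, neg_sub]
  set Φ : RN N → ℂ := fun u => f u * (starRingEnd ℂ) (g (u - z.1)) *
    Complex.exp (-(Complex.I * ((inner ℝ u z.2 : ℝ) : ℂ))) with hΦ
  have hΦi : Integrable Φ := by
    have h1 := hf.integrable_mul_conj hω hg 0 (-z.1) 1 one_ne_zero
    simp only [one_smul, zero_add, neg_add_eq_sub] at h1
    refine h1.mul_bdd (c := 1) (Continuous.aestronglyMeasurable (by fun_prop)) ?_
    exact .of_forall fun t => (norm_exp_neg_I_mul _).le
  have hΨi : Integrable fun v => (starRingEnd ℂ) (Φ v) :=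
    (LinearIsometryEquiv.integrable_comp_iff Complex.conjLIE).2 hΦi
  have hprod : Integrable (fun q : RN N × RN N => Φ q.1 * (starRingEnd ℂ) (Φ q.2)) :=
    hΦi.mul_prod hΨi
  have hmp := measurePreserving_wigner_coordinates (N := N) τ
  -- `|∫ Φ|²` as a double integral, rewritten in the coordinates `(y, t)` of the Wigner transform.
  have hV : ((spectrogram g f z : ℝ) : ℂ) = ∫ y : RN N, ∫ t : RN N,
      Φ (y + τ • t) * (starRingEnd ℂ) (Φ (y + (-(1 - τ)) • t)) := by
    have e1 : ((spectrogram g f z : ℝ) : ℂ) = (∫ u, Φ u) * ∫ v, (starRingEnd ℂ) (Φ v) := by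
      rw [integral_conj, Complex.mul_conj, Complex.normSq_eq_norm_sq]
      rfl
    have e2 := integral_map hmp.measurable.aemeasurable (by
      rw [hmp.map_eq]; exact hprod.aestronglyMeasurable)
    rw [hmp.map_eq] at e2
    rw [e1, ← integral_prod_mul]
    exact e2.trans (integral_prod _ (hmp.integrable_comp_of_integrable hprod))
  have hinner : ∀ y : RN N,
      ‖∫ t : RN N, Φ (y + τ • t) * (starRingEnd ℂ) (Φ (y + (-(1 - τ)) • t))‖ₑ ≤
        ∫⁻ η, ‖wig τ f (y, η)‖ₑ * ‖wig τ g ((y, η) - z)‖ₑ := by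
    intro y
    have e : (∫ t : RN N, Φ (y + τ • t) * (starRingEnd ℂ) (Φ (y + (-(1 - τ)) • t))) =
        ∫ t, (fun t => f (y + τ • t) * (starRingEnd ℂ) (f (y + (-(1 - τ)) • t))) t *
          ((starRingEnd ℂ) ((fun t => g (y - z.1 + τ • t) *
            (starRingEnd ℂ) (g (y - z.1 + (-(1 - τ)) • t))) t) *
          Complex.exp (-(Complex.I * ((inner ℝ t z.2 : ℝ) : ℂ)))) := by
      congr 1
      ext t
      -- The two modulations combine to one in `t` alone: the contributions of `y` cancel, and those
      -- of `t` add with coefficient `τ + (1 - τ) = 1`.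
      have e3 : Complex.exp (-(Complex.I * ((inner ℝ t z.2 : ℝ) : ℂ))) =
          Complex.exp (-(Complex.I * ((inner ℝ (y + τ • t) z.2 : ℝ) : ℂ))) *
          (starRingEnd ℂ) (Complex.exp
            (-(Complex.I * ((inner ℝ (y + (-(1 - τ)) • t) z.2 : ℝ) : ℂ)))) := by
        simp only [← Complex.exp_conj, map_neg, map_mul, Complex.conj_I, Complex.conj_ofReal,
          ← Complex.exp_add, inner_add_left, inner_smul_left, conj_trivial]
        congr 1
        push_cast
        ring
      simp only [hΦ]
      rw [e3]
      simp only [map_mul, Complex.conj_conj]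
      rw [show y + τ • t - z.1 = y - z.1 + τ • t by abel,
        show y + (-(1 - τ)) • t - z.1 = y - z.1 + (-(1 - τ)) • t by abel]
      ring
    rw [e, integral_mul_conj_modulate (by have := hf.continuous; fun_prop)
      (hf.integrable_mul_conj hω hf y y _ hτ0.ne') ?_
      (hg.integrable_mul_conj hω hg _ _ _ hτ0.ne')]
    · simp only [fourierHat_mul_conj_eq_wig]
      -- The Parseval factor is simply discarded; `constD5` does not contain it.
      have hc : ‖((((2 * Real.pi) ^ N)⁻¹ : ℝ) : ℂ)‖ₑ ≤ 1 := by
        rw [← ofReal_norm, Complex.norm_real, Real.norm_of_nonneg (by positivity),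
          ENNReal.ofReal_le_one]
        exact inv_le_one_of_one_le₀ (one_le_pow₀ (by linarith [Real.two_le_pi]))
      rw [enorm_mul]
      refine (mul_le_of_le_one_left zero_le hc).trans
        ((enorm_integral_le_lintegral_enorm _).trans_eq ?_)
      simp only [enorm_mul, RCLike.enorm_conj]
      rfl
    · simp only [funext (fourierHat_mul_conj_eq_wig τ f y)]
      exact integrable_wig_right hω hτ0 hτ1 hf hf' y
  have hm : Measurable fun w : RN N × RN N => ‖wig τ f w‖ₑ * ‖wig τ g (w - z)‖ₑ :=
    (stronglyMeasurable_wig hf.continuous).enorm.mul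
      ((stronglyMeasurable_wig hg.continuous).enorm.comp (measurable_sub_const z))
  calc ‖spectrogram g f z‖ₑ = ‖((spectrogram g f z : ℝ) : ℂ)‖ₑ := by
        rw [← ofReal_norm, ← ofReal_norm, Complex.norm_real]
    _ ≤ ∫⁻ y : RN N, ‖∫ t : RN N, Φ (y + τ • t) * (starRingEnd ℂ) (Φ (y + (-(1 - τ)) • t))‖ₑ := by
        rw [hV]
        exact enorm_integral_le_lintegral_enorm _
    _ ≤ ∫⁻ y : RN N, ∫⁻ η : RN N, ‖wig τ f (y, η)‖ₑ * ‖wig τ g ((y, η) - z)‖ₑ :=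
        lintegral_mono hinner
    _ = _ := (lintegral_prod _ hm.aemeasurable).symm

theorem wNormPhase_top_spectrogram_le (hω : IsWeightFunction ω) {K : ℝ} (hK : WeightAlpha ω K)
    {p : ℝ≥0∞} (hp : 1 ≤ p) (hτ0 : 0 < τ) (hτ1 : τ < 1)
    (hf : HasExpDecay ω f) (hf' : HasExpDecay ω (fourierHat f)) (hg : HasExpDecay ω g) {lam : ℝ}
    (hlam : 0 ≤ lam) :
    wNormPhase ω lam (spectrogram g f) ∞ ≤
      constD5 ω K p τ g lam * wNormPhase ω (K * lam) (wig τ f) p := by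
  set W := wig τ f
  set H := wig (1 - τ) fun t => g (-t)
  have hWm : StronglyMeasurable W := stronglyMeasurable_wig hf.continuous
  have hHm : StronglyMeasurable H :=
    stronglyMeasurable_wig (hg.continuous.comp continuous_neg)
  have hEc : Continuous fun w : RN N × RN N => Real.exp (K * lam * ω (phaseNorm w)) :=
    Real.continuous_exp.comp (continuous_const.mul hω.continuous_phase)
  have hu : AEStronglyMeasurable (fun w => Real.exp (K * lam * ω (phaseNorm w)) • W w) volume :=
    (hEc.stronglyMeasurable.smul hWm).aestronglyMeasurable
  have hv : AEStronglyMeasurable (fun w => Real.exp (K * lam * ω (phaseNorm w)) • H w) volume :=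
    (hEc.stronglyMeasurable.smul hHm).aestronglyMeasurable
  rw [wNormPhase, eLpNorm_exponent_top]
  refine eLpNormEssSup_le_of_ae_enorm_bound (.of_forall fun z => ?_)
  have hmp : MeasurePreserving (fun w : RN N × RN N => z - w) :=
    Measure.measurePreserving_sub_left volume z
  calc ‖Real.exp (lam * ω (phaseNorm z)) • spectrogram g f z‖ₑ
      ≤ ENNReal.ofReal (Real.exp (lam * ω (phaseNorm z))) * ∫⁻ w, ‖W w‖ₑ * ‖H (z - w)‖ₑ := by
        rw [enorm_smul, Real.enorm_of_nonneg (Real.exp_nonneg _)]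
        gcongr
        exact enorm_spectrogram_le hω hτ0 hτ1 hf hf' hg z
    _ = ∫⁻ w, ENNReal.ofReal (Real.exp (lam * ω (phaseNorm z))) * (‖W w‖ₑ * ‖H (z - w)‖ₑ) :=
        (lintegral_const_mul' _ _ ENNReal.ofReal_ne_top).symm
    _ ≤ ∫⁻ w, ENNReal.ofReal (Real.exp (K * lam)) *
          (‖Real.exp (K * lam * ω (phaseNorm w)) • W w‖ₑ *
            ‖Real.exp (K * lam * ω (phaseNorm (z - w))) • H (z - w)‖ₑ) := by
        refine lintegral_mono fun w => ?_
        rw [enorm_smul, enorm_smul, Real.enorm_of_nonneg (Real.exp_nonneg _),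
          Real.enorm_of_nonneg (Real.exp_nonneg _), mul_mul_mul_comm, ← mul_assoc (ENNReal.ofReal (Real.exp (K * lam))),
          ← ENNReal.ofReal_mul (Real.exp_nonneg _), ← ENNReal.ofReal_mul (Real.exp_nonneg _),
          ← Real.exp_add, ← Real.exp_add]
        gcongr
        -- With `z = w + (z - w)`, `(α)` splits the weight and leaves the factor `e^{Kλ}` of
        -- `constD5`.
        have := hω.phase_add_le hK w (z - w)
        rw [add_sub_cancel] at this
        nlinarith
    _ = ENNReal.ofReal (Real.exp (K * lam)) *
          ∫⁻ w, ‖Real.exp (K * lam * ω (phaseNorm w)) • W w‖ₑ *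
            ‖Real.exp (K * lam * ω (phaseNorm (z - w))) • H (z - w)‖ₑ :=
        lintegral_const_mul' _ _ ENNReal.ofReal_ne_top
    _ ≤ ENNReal.ofReal (Real.exp (K * lam)) * (wNormPhase ω (K * lam) W p *
          wNormPhase ω (K * lam) H (ENNReal.conjExponent p)) := by
        gcongr
        have hv' := eLpNorm_comp_measurePreserving (p := ENNReal.conjExponent p) hv hmp
        rw [wNormPhase, wNormPhase, ← hv']
        exact lintegral_enorm_mul_enorm_le hu (hv.comp_measurePreserving hmp)
          (ENNReal.HolderConjugate.conjExponent hp)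
    _ = _ := by
        rw [constD5]
        ring

end Spectrogram

/-! ### Reconstruction from the short-time Fourier transform and covariance -/

section Inversion

variable {N : ℕ} {ω : ℝ → ℝ} {f g : RN N → ℂ} {τ : ℝ}

theorem integral_fourierHat_mul_exp {φ : RN N → ℂ} (hc : Continuous φ) (hφ : Integrable φ)
    (hφ' : Integrable (fourierHat φ)) (t : RN N) :
    ∫ ξ, fourierHat φ ξ * Complex.exp (Complex.I * ((inner ℝ t ξ : ℝ) : ℂ)) =
      ((2 * Real.pi) ^ N : ℝ) * φ t := by
  have hFi : Integrable (FourierTransform.fourier φ) := by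
    rw [funext (fourier_eq_fourierHat φ)]
    exact hφ'.comp_smul (by positivity)
  have h := hφ.fourierInv_fourier_eq hFi hc.continuousAt (v := t)
  rw [Real.fourierInv_eq'] at h
  have e : (∫ w : RN N, Complex.exp (((2 * Real.pi * inner ℝ w t : ℝ) : ℂ) * Complex.I) •
      FourierTransform.fourier φ w) = ∫ w : RN N, (fun ξ => fourierHat φ ξ *
        Complex.exp (Complex.I * ((inner ℝ t ξ : ℝ) : ℂ))) ((2 * Real.pi) • w) := by
    congr 1
    ext w
    simp only [fourier_eq_fourierHat, smul_eq_mul, inner_smul_right, real_inner_comm]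
    rw [mul_comm, mul_comm Complex.I]
  rw [e, Measure.integral_comp_smul volume (fun ξ => fourierHat φ ξ *
        Complex.exp (Complex.I * ((inner ℝ t ξ : ℝ) : ℂ))), finrank_euclideanSpace_fin,
    abs_of_pos (by positivity), Complex.real_smul] at h
  rw [← h, ← mul_assoc, ← Complex.ofReal_mul, mul_inv_cancel₀ (by positivity), Complex.ofReal_one,
    one_mul]

/-- The time-frequency shift `π(x, ξ) g (t) = e^{i t·ξ} g(t - x)`. -/
noncomputable def tfShift (z : RN N × RN N) (g : RN N → ℂ) (t : RN N) : ℂ :=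
  Complex.exp (Complex.I * ((inner ℝ t z.2 : ℝ) : ℂ)) * g (t - z.1)

theorem norm_exp_I_mul (r : ℝ) : ‖Complex.exp (Complex.I * (r : ℂ))‖ = 1 := by
  rw [Complex.norm_exp]
  simp

theorem norm_tfShift (z : RN N × RN N) (g : RN N → ℂ) (t : RN N) :
    ‖tfShift z g t‖ = ‖g (t - z.1)‖ := by
  rw [tfShift, norm_mul, norm_exp_I_mul, one_mul]

theorem continuous_tfShift (hg : Continuous g) :
    Continuous fun q : (RN N × RN N) × RN N => tfShift q.1 g q.2 := by
  unfold tfShift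
  fun_prop

theorem fourierHat_mul_conj_eq_stft (g f : RN N → ℂ) (x ξ : RN N) :
    fourierHat (fun y => f y * (starRingEnd ℂ) (g (y - x))) ξ = stft g f (x, ξ) := by
  unfold fourierHat stft
  congr 1
  ext y
  ring

theorem integrable_of_exp_phase_bound (hω : IsWeightFunction ω) {F : RN N × RN N → ℂ}
    (hF : AEStronglyMeasurable F volume)
    (h : ∀ s : ℝ, ∃ C : ℝ, ∀ z, Real.exp (s * ω (phaseNorm z)) * ‖F z‖ ≤ C) :
    Integrable F := by
  rw [← memLp_one_iff_integrable]
  refine ⟨hF, ?_⟩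
  simpa [wNormPhase] using wNormPhase_lt_top hω h 0 le_rfl

theorem integrable_stft (hω : IsWeightFunction ω) (hf : HasExpDecay ω f)
    (hf' : HasExpDecay ω (fourierHat f)) (hg : HasExpDecay ω g)
    (hg' : HasExpDecay ω (fourierHat g)) : Integrable (stft g f) :=
  integrable_of_exp_phase_bound hω
    (stronglyMeasurable_stft hf.continuous hg.continuous).aestronglyMeasurable
    (exists_exp_mul_norm_stft_le hω hf hf' hg hg')

theorem HasExpDecay.integrable_norm_sq (hω : IsWeightFunction ω) (hg : HasExpDecay ω g) :
    Integrable fun y => ‖g y‖ ^ 2 := by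
  have h := (hg.integrable_mul_conj hω hg 0 0 1 one_ne_zero).norm
  simpa [sq] using h

/-- The inversion formula for the short-time Fourier transform. -/
theorem integral_stft_mul_tfShift (hω : IsWeightFunction ω) (hf : HasExpDecay ω f)
    (hf' : HasExpDecay ω (fourierHat f)) (hg : HasExpDecay ω g)
    (hg' : HasExpDecay ω (fourierHat g)) (t : RN N) :
    ∫ z, stft g f z * tfShift z g t = ((2 * Real.pi) ^ N * ∫ y, ‖g y‖ ^ 2 : ℝ) * f t := by
  have hV := integrable_stft hω hf hf' hg hg'
  obtain ⟨C, hC⟩ := hg.exists_norm_le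
  have hVt : Integrable fun z => stft g f z * tfShift z g t := by
    refine hV.mul_bdd (c := C) ?_ (.of_forall fun z => ?_)
    · exact ((continuous_tfShift hg.continuous).comp
        (continuous_id.prodMk continuous_const)).aestronglyMeasurable
    · rw [norm_tfShift]
      exact hC _
  -- For fixed `x`, integration in `ξ` is Fourier inversion for `y ↦ f(y) conj(g(y - x))`, which
  -- returns `f(t) |g(t - x)|²`. Integration in `x` then produces `‖g‖₂²`.
  have hinner : ∀ x : RN N, ∫ ξ, stft g f (x, ξ) * tfShift (x, ξ) g t =
      ((2 * Real.pi) ^ N : ℝ) * f t * ((‖g (t - x)‖ ^ 2 : ℝ) : ℂ) := by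
    intro x
    have hcont : Continuous fun y => f y * (starRingEnd ℂ) (g (y - x)) := by
      have h1 := hf.continuous
      have h2 := hg.continuous
      fun_prop
    have hint : Integrable fun y => f y * (starRingEnd ℂ) (g (y - x)) := by
      have h1 := hf.integrable_mul_conj hω hg 0 (-x) 1 one_ne_zero
      simpa only [one_smul, zero_add, neg_add_eq_sub] using h1
    have hint' : Integrable (fourierHat fun y => f y * (starRingEnd ℂ) (g (y - x))) := by
      refine HasExpDecay.integrable hω (.of_pos hω (continuous_fourierHat hint) fun s hs => ?_)
      obtain ⟨C, hC⟩ := exists_exp_mul_norm_stft_le hω hf hf' hg hg' s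
      refine ⟨C, fun ξ => le_trans ?_ (hC (x, ξ))⟩
      rw [fourierHat_mul_conj_eq_stft]
      gcongr
      exact hω.monotoneOn (norm_nonneg ξ) (phaseNorm_nonneg _) (norm_snd_le_phaseNorm (x, ξ))
    have h := integral_fourierHat_mul_exp hcont hint hint' t
    simp only [fourierHat_mul_conj_eq_stft] at h
    simp only [tfShift, ← mul_assoc]
    rw [integral_mul_const, h, mul_assoc, mul_assoc, mul_assoc, mul_comm ((starRingEnd ℂ) _),
      Complex.mul_conj, Complex.normSq_eq_norm_sq]
  rw [Measure.volume_eq_prod, integral_prod _ hVt]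
  simp only [hinner]
  rw [integral_const_mul, integral_complex_ofReal, integral_sub_left_eq_self (fun y => ‖g y‖ ^ 2)]
  push_cast
  ring

/-- The inversion formula is placed inside a linear functional of `f`, and Fubini moves the
functional onto the shifted windows. It is applied once to each slot of the Wigner transform, with
`A` the affine argument of that slot. -/
theorem enorm_integral_mul_le (hω : IsWeightFunction ω) (hf : HasExpDecay ω f)
    (hf' : HasExpDecay ω (fourierHat f)) (hg : HasExpDecay ω g)
    (hg' : HasExpDecay ω (fourierHat g)) {k : RN N → ℂ} (hk : Integrable k) {A : RN N → RN N}
    (hA : Continuous A) :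
    ENNReal.ofReal ((2 * Real.pi) ^ N * ∫ y, ‖g y‖ ^ 2) * ‖∫ t, k t * f (A t)‖ₑ ≤
      ∫⁻ z, ‖stft g f z‖ₑ * ‖∫ t, k t * tfShift z g (A t)‖ₑ := by
  have hV := integrable_stft hω hf hf' hg hg'
  obtain ⟨C, hC⟩ := hg.exists_norm_le
  have hc0 : 0 ≤ (2 * Real.pi) ^ N * ∫ y, ‖g y‖ ^ 2 := by
    have : 0 ≤ ∫ y, ‖g y‖ ^ 2 := integral_nonneg fun y => by positivity
    positivity
  have hint : Integrable (Function.uncurry fun (t : RN N) (z : RN N × RN N) =>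
      k t * (stft g f z * tfShift z g (A t))) (volume.prod volume) := by
    have h1 := (hk.mul_prod hV).mul_bdd (c := C)
      (g := fun q : RN N × (RN N × RN N) => tfShift q.2 g (A q.1))
      (((continuous_tfShift hg.continuous).comp (continuous_snd.prodMk
        (hA.comp continuous_fst))).aestronglyMeasurable)
      (.of_forall fun q => by rw [norm_tfShift]; exact hC _)
    simpa only [Function.uncurry_def, mul_assoc] using h1
  calc ENNReal.ofReal ((2 * Real.pi) ^ N * ∫ y, ‖g y‖ ^ 2) * ‖∫ t, k t * f (A t)‖ₑ
      = ‖∫ t, ∫ z, k t * (stft g f z * tfShift z g (A t))‖ₑ := by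
        simp only [integral_const_mul, integral_stft_mul_tfShift hω hf hf' hg hg']
        simp only [mul_left_comm (k _)]
        rw [integral_const_mul, enorm_mul, ← ofReal_norm ((_ : ℝ) : ℂ), Complex.norm_real,
          Real.norm_of_nonneg hc0]
    _ = ‖∫ z, ∫ t, k t * (stft g f z * tfShift z g (A t))‖ₑ := by
        rw [integral_integral_swap hint]
    _ = ‖∫ z, stft g f z * ∫ t, k t * tfShift z g (A t)‖ₑ := by
        simp only [mul_left_comm (k _), integral_const_mul]
    _ ≤ _ := by
        refine (enorm_integral_le_lintegral_enorm _).trans_eq ?_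
        simp only [enorm_mul]

/-- Covariance under time-frequency shifts: translating `t` by `z₁.1 - z₂.1` recentres both windows
at a common point, and the remaining modulations merge into the kernel of `wig τ g` and a phase
independent of `t`. -/
theorem enorm_crossWig_tfShift (τ : ℝ) (g : RN N → ℂ) (z₁ z₂ z : RN N × RN N) :
    ‖crossWig τ (tfShift z₁ g) (tfShift z₂ g) z‖ₑ =
      ‖wig τ g (z - ((1 - τ) • z₁.1 + τ • z₂.1, τ • z₁.2 + (1 - τ) • z₂.2))‖ₑ := by
  set w := z - ((1 - τ) • z₁.1 + τ • z₂.1, τ • z₁.2 + (1 - τ) • z₂.2) with hw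
  have h1 : w.1 = z.1 - ((1 - τ) • z₁.1 + τ • z₂.1) := rfl
  have h2 : w.2 = z.2 - (τ • z₁.2 + (1 - τ) • z₂.2) := rfl
  have key : crossWig τ (tfShift z₁ g) (tfShift z₂ g) z =
      Complex.exp (Complex.I * ((inner ℝ z.1 (z₁.2 - z₂.2) - inner ℝ (z₁.1 - z₂.1) w.2 : ℝ) : ℂ)) *
        wig τ g w := by
    unfold wig crossWig
    rw [← integral_const_mul]
    conv_rhs => rw [← integral_sub_right_eq_self _ (z₁.1 - z₂.1)]
    congr 1
    ext t
    simp only [tfShift, map_mul, ← Complex.exp_conj, Complex.conj_I, Complex.conj_ofReal]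
    have a1 : z.1 + τ • t - z₁.1 = w.1 + τ • (t - (z₁.1 - z₂.1)) := by
      rw [h1]
      module
    have a2 : z.1 - (1 - τ) • t - z₂.1 = w.1 - (1 - τ) • (t - (z₁.1 - z₂.1)) := by
      rw [h1]
      module
    rw [a1, a2]
    have e : Complex.exp (-(Complex.I * ((inner ℝ t z.2 : ℝ) : ℂ))) *
        Complex.exp (Complex.I * ((inner ℝ (z.1 + τ • t) z₁.2 : ℝ) : ℂ)) *
        Complex.exp (-Complex.I * ((inner ℝ (z.1 - (1 - τ) • t) z₂.2 : ℝ) : ℂ)) =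
        Complex.exp (Complex.I *
          ((inner ℝ z.1 (z₁.2 - z₂.2) - inner ℝ (z₁.1 - z₂.1) w.2 : ℝ) : ℂ)) *
        Complex.exp (-(Complex.I * ((inner ℝ (t - (z₁.1 - z₂.1)) w.2 : ℝ) : ℂ))) := by
      simp only [← Complex.exp_add, h2, inner_add_left, inner_sub_left, inner_smul_left,
        inner_sub_right, inner_add_right, inner_smul_right, conj_trivial]
      congr 1
      push_cast
      ring
    linear_combination (g (w.1 + τ • (t - (z₁.1 - z₂.1))) *
      (starRingEnd ℂ) (g (w.1 - (1 - τ) • (t - (z₁.1 - z₂.1))))) * e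
  rw [key, enorm_mul, ← ofReal_norm, norm_exp_I_mul, ENNReal.ofReal_one, one_mul]

theorem integrable_tfShift (hg : Continuous g) (hgi : Integrable g) (z : RN N × RN N) :
    Integrable (tfShift z g) := by
  have hc : Continuous (tfShift z g) := by
    unfold tfShift
    fun_prop
  refine (hgi.comp_sub_right z.1).norm.mono' hc.aestronglyMeasurable (.of_forall fun t => ?_)
  exact (norm_tfShift z g t).le

/-- The Wigner transform of `f` is dominated by a superposition of shifted Wigner transforms of the
window. -/
theorem enorm_wig_le_lintegral_stft (hω : IsWeightFunction ω) (hτ0 : 0 < τ) (hτ1 : τ < 1)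
    (hf : HasExpDecay ω f) (hf' : HasExpDecay ω (fourierHat f)) (hg : HasExpDecay ω g)
    (hg' : HasExpDecay ω (fourierHat g)) (z : RN N × RN N) :
    ENNReal.ofReal ((2 * Real.pi) ^ N * ∫ y, ‖g y‖ ^ 2) ^ 2 * ‖wig τ f z‖ₑ ≤
      ∫⁻ z₁, ‖stft g f z₁‖ₑ * ∫⁻ z₂, ‖stft g f z₂‖ₑ *
        ‖wig τ g (z - ((1 - τ) • z₁.1 + τ • z₂.1, τ • z₁.2 + (1 - τ) • z₂.2))‖ₑ := by
  set c := ENNReal.ofReal ((2 * Real.pi) ^ N * ∫ y, ‖g y‖ ^ 2) with hc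
  have h1τ : -(1 - τ) ≠ 0 := by linarith
  have hmod : ∀ {u : RN N → ℂ}, Integrable u → Integrable fun t : RN N =>
      Complex.exp (-(Complex.I * ((inner ℝ t z.2 : ℝ) : ℂ))) * u t := fun hu =>
    hu.bdd_mul (c := 1) (Continuous.aestronglyMeasurable (by fun_prop))
      (.of_forall fun t => (norm_exp_neg_I_mul _).le)
  have hconj : ∀ {u : RN N → ℂ}, Integrable u → Integrable fun t => (starRingEnd ℂ) (u t) :=
    fun hu => (LinearIsometryEquiv.integrable_comp_iff Complex.conjLIE).2 hu
  have s1 : c * ‖wig τ f z‖ₑ ≤ ∫⁻ z₁, ‖stft g f z₁‖ₑ * ‖crossWig τ (tfShift z₁ g) f z‖ₑ := by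
    have hk := hmod (hconj (integrable_comp_add_smul (hf.integrable hω) z.1 h1τ))
    have e : ∀ h : RN N → ℂ, crossWig τ h f z = ∫ t,
        (Complex.exp (-(Complex.I * ((inner ℝ t z.2 : ℝ) : ℂ))) *
          (starRingEnd ℂ) (f (z.1 + (-(1 - τ)) • t))) * h (z.1 + τ • t) := by
      intro h
      unfold crossWig
      refine integral_congr_ae (.of_forall fun t => ?_)
      simp only [neg_smul, ← sub_eq_add_neg]
      ring
    simp only [wig_eq_crossWig, e]
    exact enorm_integral_mul_le hω hf hf' hg hg' hk (by fun_prop)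
  have s2 : ∀ z₁ : RN N × RN N, c * ‖crossWig τ (tfShift z₁ g) f z‖ₑ ≤
      ∫⁻ z₂, ‖stft g f z₂‖ₑ * ‖crossWig τ (tfShift z₁ g) (tfShift z₂ g) z‖ₑ := by
    intro z₁
    have hk := hconj (hmod (integrable_comp_add_smul
      (integrable_tfShift hg.continuous (hg.integrable hω) z₁) z.1 hτ0.ne'))
    -- The second slot is conjugate-linear, so the whole integral is conjugated to make it linear in
    -- `h`; the norm does not change.
    have e : ∀ h : RN N → ℂ, ‖crossWig τ (tfShift z₁ g) h z‖ₑ = ‖∫ t, (starRingEnd ℂ)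
        (Complex.exp (-(Complex.I * ((inner ℝ t z.2 : ℝ) : ℂ))) *
          tfShift z₁ g (z.1 + τ • t)) * h (z.1 - (1 - τ) • t)‖ₑ := by
      intro h
      rw [← RCLike.enorm_conj, crossWig, ← integral_conj]
      simp only [map_mul, Complex.conj_conj]
    simp only [e]
    exact enorm_integral_mul_le hω hf hf' hg hg' hk (by fun_prop)
  calc c ^ 2 * ‖wig τ f z‖ₑ = c * (c * ‖wig τ f z‖ₑ) := by ring
    _ ≤ c * ∫⁻ z₁, ‖stft g f z₁‖ₑ * ‖crossWig τ (tfShift z₁ g) f z‖ₑ := by gcongr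
    _ = ∫⁻ z₁, ‖stft g f z₁‖ₑ * (c * ‖crossWig τ (tfShift z₁ g) f z‖ₑ) := by
        rw [← lintegral_const_mul' _ _ ENNReal.ofReal_ne_top]
        exact lintegral_congr fun z₁ => mul_left_comm _ _ _
    _ ≤ _ := by
        refine lintegral_mono fun z₁ => ?_
        simp only [← enorm_crossWig_tfShift]
        gcongr
        exact s2 z₁

end Inversion

/-! ### The Wigner transform bounded by the spectrogram -/

section WignerBound

variable {N : ℕ} {ω : ℝ → ℝ} {f g : RN N → ℂ} {τ K a b : ℝ}

theorem eLpNorm_two_sq_eq {X E : Type*} [MeasurableSpace X] {μ : Measure X}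
    [NormedAddCommGroup E] {h : X → E} (hi : Integrable (fun x => ‖h x‖ ^ 2) μ) :
    eLpNorm h 2 μ ^ 2 = ENNReal.ofReal (∫ x, ‖h x‖ ^ 2 ∂μ) := by
  rw [ofReal_integral_eq_lintegral_ofReal hi (.of_forall fun x => by positivity),
    eLpNorm_eq_lintegral_rpow_enorm_toReal two_ne_zero ENNReal.ofNat_ne_top, ← ENNReal.rpow_natCast,
    ← ENNReal.rpow_mul]
  simp only [ENNReal.toReal_ofNat, Nat.cast_ofNat, one_div, inv_mul_cancel₀ (two_ne_zero' ℝ),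
    ENNReal.rpow_one]
  refine lintegral_congr fun x => ?_
  rw [← ofReal_norm, ENNReal.ofReal_pow (norm_nonneg _), ← ENNReal.rpow_natCast]
  rfl

theorem integral_norm_sq_pos (hω : IsWeightFunction ω) (hg : HasExpDecay ω g) (hg0 : g ≠ 0) :
    0 < ∫ y, ‖g y‖ ^ 2 := by
  rw [integral_pos_iff_support_of_nonneg (fun y => by positivity) (hg.integrable_norm_sq hω)]
  obtain ⟨y, hy⟩ := Function.ne_iff.1 hg0
  refine IsOpen.measure_pos volume ?_ ⟨y, by simpa using hy⟩
  exact (hg.continuous.norm.pow 2).isOpen_support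

/-- Comparison of an integral over `ℝ^N` with an `L²` norm over `ℝ^{2N}`. -/
theorem integral_exp_neg_le (hω : IsWeightFunction ω) (hK : WeightAlpha ω K)
    (hb : WeightGamma ω a b) {m : ℝ} (hm : (N : ℝ) / b < m) :
    ∫ y : RN N, Real.exp (-(2 * (K ^ 2 * m)) * ω ‖y‖) ≤
      Real.exp (K * m) * (expNormPhase N ω m 2).toReal := by
  have hm0 : 0 ≤ m := (div_nonneg (Nat.cast_nonneg _) hb.1.le).trans hm.le
  have hK0 : 0 ≤ K := zero_le_one.trans hK.1
  have hi : Integrable fun z : RN N × RN N => Real.exp (-(2 * m) * ω (phaseNorm z)) :=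
    hω.integrable_exp_neg_phase hb (by rw [mul_div_assoc]; linarith)
  have hsq : ∀ z : RN N × RN N, ‖Real.exp (-m * ω (phaseNorm z))‖ ^ 2 =
      Real.exp (-(2 * m) * ω (phaseNorm z)) := fun z => by
    rw [Real.norm_of_nonneg (Real.exp_nonneg _), ← Real.exp_nat_mul]
    push_cast
    ring_nf
  have hE : (expNormPhase N ω m 2).toReal ^ 2 =
      ∫ z : RN N × RN N, Real.exp (-(2 * m) * ω (phaseNorm z)) := by
    rw [← ENNReal.toReal_pow, expNormPhase, eLpNorm_two_sq_eq (by simpa only [hsq] using hi),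
      ENNReal.toReal_ofReal (integral_nonneg fun z => by positivity)]
    simp only [hsq]
  refine (pow_le_pow_iff_left₀ (integral_nonneg fun y => (Real.exp_pos _).le)
    (by positivity) two_ne_zero).1 ?_
  -- The square of an integral over `ℝ^N` is an integral over `ℝ^{2N}`, where `(α)` compares `ω(x) +
  -- ω(ξ)` with `ω(x, ξ)`. Only a factor `K` is needed in the exponent; the given `K²` is larger.
  rw [sq, ← integral_prod_mul, mul_pow, hE, ← integral_const_mul]
  refine integral_mono_of_nonneg (.of_forall fun z => by positivity) (hi.const_mul _)
    (.of_forall fun z => ?_)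
  beta_reduce
  rw [← Real.exp_add, ← Real.exp_nat_mul, ← Real.exp_add]
  refine Real.exp_le_exp.2 ?_
  have h1 := hω.phase_le hK z
  have h2 := hω.nonneg _ (norm_nonneg z.1)
  have h3 := hω.nonneg _ (norm_nonneg z.2)
  have h4 : 2 * m * ω (phaseNorm z) ≤ 2 * m * (K * (1 + (ω ‖z.1‖ + ω ‖z.2‖))) := by gcongr
  have h5 : K ≤ K ^ 2 := by nlinarith [hK.1]
  have h6 : K * (m * (ω ‖z.1‖ + ω ‖z.2‖)) ≤ K ^ 2 * (m * (ω ‖z.1‖ + ω ‖z.2‖)) := by gcongr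
  push_cast
  nlinarith

/-- Weighted estimate for phase-space shifted Wigner transforms. -/
theorem exp_mul_norm_wig_shift_le (hω : IsWeightFunction ω) (hK : WeightAlpha ω K)
    (hb : WeightGamma ω a b) (hτ0 : 0 < τ) (hτ1 : τ < 1)
    (hg : HasExpDecay ω g) (hg' : HasExpDecay ω (fourierHat g)) {lam m : ℝ} (hlam : 0 ≤ lam)
    (hm : (N : ℝ) / b < m) (z z₁ z₂ : RN N × RN N) :
    Real.exp (lam * ω (phaseNorm z)) *
      ‖wig τ g (z - ((1 - τ) • z₁.1 + τ • z₂.1, τ • z₁.2 + (1 - τ) • z₂.2))‖ ≤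
      Real.exp (K / 2 * (1 + 2 * K) * lam) * (√((2 * Real.pi) ^ N))⁻¹ * (√((τ - τ ^ 2) ^ N))⁻¹ *
        (Real.exp (K * (1 + 2 * K) * (4 * K ^ 2 * lam + m)) *
          (wNorm ω (K ^ 2 * (4 * K ^ 2 * lam + m)) g ∞).toReal *
          (wNorm ω (K ^ 2 * (4 * K ^ 2 * lam + m)) (fourierHat g) ∞).toReal *
          (expNormPhase N ω m 2).toReal) *
        (Real.exp (K ^ 2 * (4 * K ^ 2 * lam + m) * ω (phaseNorm z₁)) *
          Real.exp (K ^ 2 * (4 * K ^ 2 * lam + m) * ω (phaseNorm z₂))) := by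
  have hm0 : 0 ≤ m := (div_nonneg (Nat.cast_nonneg _) hb.1.le).trans hm.le
  have hK1 := hK.1
  have hK0 : 0 ≤ K := zero_le_one.trans hK1
  have hd : 0 < τ - τ ^ 2 := by nlinarith
  set s := K ^ 2 * (4 * K ^ 2 * lam + m) with hs
  set Z := ((1 - τ) • z₁.1 + τ • z₂.1, τ • z₁.2 + (1 - τ) • z₂.2) with hZ
  set A := (wNorm ω s g ∞).toReal with hAdef
  set B := (wNorm ω s (fourierHat g) ∞).toReal with hBdef
  set E := (expNormPhase N ω m 2).toReal
  have hs' : 4 * K ^ 4 * lam + K ^ 2 * m = s := by rw [hs]; ring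
  have hI : Integrable fun y : RN N => Real.exp (-(2 * (K ^ 2 * m)) * ω ‖y‖) :=
    hω.integrable_exp_neg hb (hm.trans_le (by
      nlinarith [mul_le_mul_of_nonneg_right (one_le_pow₀ hK1 (n := 2)) hm0]))
  have hA0 : 0 ≤ A := ENNReal.toReal_nonneg
  have hB0 : 0 ≤ B := ENNReal.toReal_nonneg
  have hE0 : 0 ≤ E := ENNReal.toReal_nonneg
  have hw := norm_wig_le hω hτ0 hτ1 hg hg' (σ := 4 * K ^ 4 * lam) (m := K ^ 2 * m) (A := A) (B := B)
    (by positivity) (by rw [hs']; exact hg.exp_mul_norm_le hω s)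
    (by rw [hs']; exact hg'.exp_mul_norm_le hω s) hI (z - Z)
  have hIE := integral_exp_neg_le hω hK hb hm
  have hZle : phaseNorm Z ≤ 2 * max (phaseNorm z₁) (phaseNorm z₂) := by
    refine (phaseNorm_le_two_mul_max Z).trans (mul_le_mul_of_nonneg_left (max_le ?_ ?_) zero_le_two)
    · exact (convexComb_norm_le_max hτ0 hτ1).trans
        (max_le_max (norm_fst_le_phaseNorm z₁) (norm_fst_le_phaseNorm z₂))
    · have := convexComb_norm_le_max (u := z₂.2) (v := z₁.2) hτ0 hτ1
      rw [add_comm, max_comm] at this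
      exact this.trans (max_le_max (norm_snd_le_phaseNorm z₁) (norm_snd_le_phaseNorm z₂))
  have hωZ := hω.le_of_le_two_mul_max hK (phaseNorm_nonneg Z) (phaseNorm_nonneg z₁)
    (phaseNorm_nonneg z₂) hZle
  have hωz := hω.phase_add_le hK (z - Z) Z
  rw [sub_add_cancel] at hωz
  have hωw := hω.phase_le hK (z - Z)
  set p₁ := ω (phaseNorm z₁)
  set p₂ := ω (phaseNorm z₂)
  set q := ω ‖(z - Z).1‖ + ω ‖(z - Z).2‖
  have hp₁ : 0 ≤ p₁ := hω.nonneg _ (phaseNorm_nonneg _)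
  have hp₂ : 0 ≤ p₂ := hω.nonneg _ (phaseNorm_nonneg _)
  have hq : 0 ≤ q := add_nonneg (hω.nonneg _ (norm_nonneg _)) (hω.nonneg _ (norm_nonneg _))
  have hK24 : K ^ 2 ≤ K ^ 4 := pow_le_pow_right₀ hK1 (by norm_num)
  have hK12 : K ≤ K ^ 2 := by nlinarith
  -- Splitting `z = (z - Z) + Z` and applying `(α)` to the sum and to each part gives `λω(z) ≤ λ(K +
  -- 2K²) + λK²q + λK²(p₁ + p₂)`. The last term is covered since `λK² ≤ s`, and the constants fit
  -- with room to spare.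
  have hexp : lam * ω (phaseNorm z) + K * m + -(4 * K ^ 4 * lam / 2) * q ≤
      K / 2 * (1 + 2 * K) * lam + K * (1 + 2 * K) * (4 * K ^ 2 * lam + m) + (s * p₁ + s * p₂) := by
    have e1 : lam * ω (phaseNorm z) ≤
        lam * (K * (1 + (K * (1 + q) + K * (1 + (p₁ + p₂))))) := by
      refine mul_le_mul_of_nonneg_left (hωz.trans ?_) hlam
      gcongr
    have e2 : lam * K ^ 2 * q ≤ lam * K ^ 4 * q := by gcongr
    have e3 : 0 ≤ lam * K ^ 4 * q := by positivity
    have e4 : lam * K ^ 2 ≤ s := by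
      rw [hs]
      nlinarith [mul_le_mul_of_nonneg_left hK24 hlam, mul_nonneg (sq_nonneg K) hm0,
        mul_nonneg hlam (by positivity : 0 ≤ K ^ 4)]
    have e5 : lam * K ^ 2 * (p₁ + p₂) ≤ s * (p₁ + p₂) := by gcongr
    have e6 : lam * K ≤ lam * K ^ 2 := by gcongr
    have e7 : lam * K ^ 2 ≤ lam * K ^ 4 := by gcongr
    have e8 : 0 ≤ lam * K ^ 3 := by positivity
    have e9 : 0 ≤ K ^ 2 * m := by positivity
    have e10 : 0 ≤ lam * K := by positivity
    nlinarith
  calc Real.exp (lam * ω (phaseNorm z)) * ‖wig τ g (z - Z)‖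
      ≤ Real.exp (lam * ω (phaseNorm z)) * ((√((2 * Real.pi) ^ N))⁻¹ * (√((τ - τ ^ 2) ^ N))⁻¹ *
          (A * B) * (Real.exp (K * m) * E) * Real.exp (-(4 * K ^ 4 * lam / 2) * q)) := by
        refine mul_le_mul_of_nonneg_left (hw.trans ?_) (Real.exp_nonneg _)
        gcongr
    _ = Real.exp (lam * ω (phaseNorm z) + K * m + -(4 * K ^ 4 * lam / 2) * q) *
          ((√((2 * Real.pi) ^ N))⁻¹ * (√((τ - τ ^ 2) ^ N))⁻¹ * A * B * E) := by
        rw [Real.exp_add, Real.exp_add]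
        ring
    _ ≤ Real.exp (K / 2 * (1 + 2 * K) * lam + K * (1 + 2 * K) * (4 * K ^ 2 * lam + m) +
          (s * p₁ + s * p₂)) *
          ((√((2 * Real.pi) ^ N))⁻¹ * (√((τ - τ ^ 2) ^ N))⁻¹ * A * B * E) := by
        gcongr
    _ = _ := by
        rw [Real.exp_add, Real.exp_add, Real.exp_add]
        ring

/-- An `L^p` norm of `|V_g f|²` is a squared `L^{2p}` norm of `V_g f` with half the weight. Hence
the exponent `(2p)'` and the factor `2` in the relation between `μ` and `μ', μ''`. -/
theorem eLpNorm_exp_stft_sq (ω : ℝ → ℝ) (s : ℝ) (g f : RN N → ℂ) (p : ℝ≥0∞) :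
    eLpNorm (fun z => Real.exp (s * ω (phaseNorm z)) • stft g f z) (2 * p) volume ^ 2 =
      wNormPhase ω (2 * s) (spectrogram g f) p := by
  have h := eLpNorm_norm_rpow (p := p) (μ := volume)
    (fun z : RN N × RN N => Real.exp (s * ω (phaseNorm z)) • stft g f z) (zero_lt_two' ℝ)
  rw [ENNReal.ofReal_ofNat, mul_comm p, ← Nat.cast_ofNat (R := ℝ), ENNReal.rpow_natCast] at h
  rw [← h, wNormPhase]
  congr 1
  ext z
  rw [Real.rpow_natCast, norm_smul, Real.norm_of_nonneg (Real.exp_nonneg _), mul_pow,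
    ← Real.exp_nat_mul, spectrogram, smul_eq_mul]
  push_cast
  ring_nf

/-- Hölder after writing `e^{sω} = e^{(s+m)ω} e^{-mω}`. -/
theorem lintegral_enorm_stft_mul_exp_le (hω : IsWeightFunction ω) (hf : Continuous f)
    (hg : Continuous g) (s m : ℝ) {p : ℝ≥0∞} (hp : 1 ≤ p) :
    ∫⁻ z, ‖stft g f z‖ₑ * ENNReal.ofReal (Real.exp (s * ω (phaseNorm z))) ≤
      eLpNorm (fun z => Real.exp ((s + m) * ω (phaseNorm z)) • stft g f z) (2 * p) volume *
        expNormPhase N ω m (ENNReal.conjExponent (2 * p)) := by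
  have hE : ∀ r : ℝ, StronglyMeasurable fun z : RN N × RN N =>
      Real.exp (r * ω (phaseNorm z)) := fun r =>
    (Real.continuous_exp.comp (continuous_const.mul hω.continuous_phase)).stronglyMeasurable
  have hu : AEStronglyMeasurable
      (fun z => Real.exp ((s + m) * ω (phaseNorm z)) • stft g f z) volume :=
    ((hE _).smul (stronglyMeasurable_stft hf hg)).aestronglyMeasurable
  have h2p : 1 ≤ 2 * p := hp.trans (le_mul_of_one_le_left zero_le one_le_two)
  have hpq := ENNReal.HolderConjugate.conjExponent h2p
  have hqp : (ENNReal.conjExponent (2 * p)).HolderConjugate (2 * p) := hpq.symm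
  rw [mul_comm (eLpNorm _ _ _)]
  refine le_trans (lintegral_mono fun z => le_of_eq ?_)
    (lintegral_enorm_mul_enorm_le (hE (-m)).aestronglyMeasurable hu hqp)
  rw [enorm_smul, Real.enorm_of_nonneg (Real.exp_nonneg _), Real.enorm_of_nonneg (Real.exp_nonneg _),
    ← mul_assoc, ← ENNReal.ofReal_mul (Real.exp_nonneg _), ← Real.exp_add, mul_comm]
  ring_nf

theorem sqrt_pow_eq_rpow {x : ℝ} (hx : 0 ≤ x) (n : ℕ) : √(x ^ n) = x ^ ((n : ℝ) / 2) := by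
  rw [Real.sqrt_eq_rpow, ← Real.rpow_natCast, ← Real.rpow_mul hx]
  congr 1
  ring

/-- The estimate for one fixed pair of exponents. The kernel bound is a product in `z₁` and `z₂`, so
the double integral over phase space is at most a constant times `Y²`, and Hölder is applied to `Y`.
No condition on `m₂` is needed, because that step holds in `[0, ∞]`. -/
theorem wNormPhase_top_wig_le (hω : IsWeightFunction ω) (hK : WeightAlpha ω K)
    (hb : WeightGamma ω a b) {p : ℝ≥0∞} (hp : 1 ≤ p) (hτ0 : 0 < τ) (hτ1 : τ < 1)
    (hf : HasExpDecay ω f) (hf' : HasExpDecay ω (fourierHat f)) (hg : HasExpDecay ω g)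
    (hg' : HasExpDecay ω (fourierHat g)) (hg0 : g ≠ 0) {lam m₁ : ℝ} (hlam : 0 ≤ lam)
    (hm₁ : (N : ℝ) / b < m₁) (m₂ : ℝ) :
    wNormPhase ω lam (wig τ f) ∞ ≤
      ENNReal.ofReal (Real.exp (K / 2 * (1 + 2 * K) * lam)) /
      (ENNReal.ofReal ((2 * Real.pi) ^ ((5 / 2 : ℝ) * (N : ℝ)) *
          (τ - τ ^ 2) ^ ((N : ℝ) / 2)) *
        MeasureTheory.eLpNorm g 2 MeasureTheory.volume ^ 4) *
      (ENNReal.ofReal (Real.exp (K * (1 + 2 * K) * (4 * K ^ 2 * lam + m₁))) *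
        wNorm ω (K ^ 2 * (4 * K ^ 2 * lam + m₁)) g ∞ *
        wNorm ω (K ^ 2 * (4 * K ^ 2 * lam + m₁)) (fourierHat g) ∞ *
        expNormPhase N ω m₁ 2 *
        expNormPhase N ω m₂ (ENNReal.conjExponent (2 * p)) ^ 2) *
      wNormPhase ω (8 * K ^ 4 * lam + 2 * (K ^ 2 * m₁ + m₂)) (spectrogram g f) p := by
  have hd : 0 < τ - τ ^ 2 := by nlinarith
  have hm0 : 0 ≤ m₁ := (div_nonneg (Nat.cast_nonneg _) hb.1.le).trans hm₁.le
  set s := K ^ 2 * (4 * K ^ 2 * lam + m₁) with hs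
  set G := ∫ y, ‖g y‖ ^ 2 with hG
  have hG0 : 0 < G := integral_norm_sq_pos hω hg hg0
  set P := (2 * Real.pi) ^ N with hP
  have hP0 : 0 < P := by positivity
  set D := (τ - τ ^ 2) ^ N with hD
  have hD0 : 0 < D := by positivity
  set e₁ := Real.exp (K / 2 * (1 + 2 * K) * lam) with he₁
  set M := Real.exp (K * (1 + 2 * K) * (4 * K ^ 2 * lam + m₁)) *
    (wNorm ω s g ∞).toReal * (wNorm ω s (fourierHat g) ∞).toReal *
    (expNormPhase N ω m₁ 2).toReal with hM
  set c₀ := e₁ * (√P)⁻¹ * (√D)⁻¹ * M with hc₀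
  have hM0 : 0 ≤ M := by positivity
  have hc₀0 : 0 ≤ c₀ := by positivity
  set Y := ∫⁻ z, ‖stft g f z‖ₑ * ENNReal.ofReal (Real.exp (s * ω (phaseNorm z))) with hY
  have hYle := lintegral_enorm_stft_mul_exp_le hω hf.continuous hg.continuous s m₂ hp
  have hpt : ∀ z, ENNReal.ofReal (P * G) ^ 2 *
      ‖Real.exp (lam * ω (phaseNorm z)) • wig τ f z‖ₑ ≤ ENNReal.ofReal c₀ * Y ^ 2 := by
    intro z
    rw [enorm_smul, Real.enorm_of_nonneg (Real.exp_nonneg _)]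
    set ez := ENNReal.ofReal (Real.exp (lam * ω (phaseNorm z))) with hez
    calc ENNReal.ofReal (P * G) ^ 2 * (ez * ‖wig τ f z‖ₑ)
        = ez * (ENNReal.ofReal (P * G) ^ 2 * ‖wig τ f z‖ₑ) := mul_left_comm _ _ _
      _ ≤ ez * ∫⁻ z₁, ‖stft g f z₁‖ₑ * ∫⁻ z₂, ‖stft g f z₂‖ₑ *
        ‖wig τ g (z - ((1 - τ) • z₁.1 + τ • z₂.1, τ • z₁.2 + (1 - τ) • z₂.2))‖ₑ := by
          gcongr
          exact enorm_wig_le_lintegral_stft hω hτ0 hτ1 hf hf' hg hg' z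
      _ = ∫⁻ z₁, ‖stft g f z₁‖ₑ * ∫⁻ z₂, ‖stft g f z₂‖ₑ * (ez *
        ‖wig τ g (z - ((1 - τ) • z₁.1 + τ • z₂.1, τ • z₁.2 + (1 - τ) • z₂.2))‖ₑ) := by
          rw [← lintegral_const_mul' _ _ ENNReal.ofReal_ne_top]
          refine lintegral_congr fun z₁ => ?_
          rw [mul_left_comm, ← lintegral_const_mul' _ _ ENNReal.ofReal_ne_top]
          congr 1
          exact lintegral_congr fun z₂ => mul_left_comm _ _ _
      _ ≤ ∫⁻ z₁, ‖stft g f z₁‖ₑ * ∫⁻ z₂, ‖stft g f z₂‖ₑ * (ENNReal.ofReal c₀ *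
            (ENNReal.ofReal (Real.exp (s * ω (phaseNorm z₁))) *
              ENNReal.ofReal (Real.exp (s * ω (phaseNorm z₂))))) := by
          refine lintegral_mono fun z₁ => mul_le_mul_right (lintegral_mono fun z₂ =>
            mul_le_mul_right ?_ _) _
          rw [hez, ← ofReal_norm, ← ENNReal.ofReal_mul (Real.exp_nonneg _),
            ← ENNReal.ofReal_mul (Real.exp_nonneg _), ← ENNReal.ofReal_mul hc₀0]
          exact ENNReal.ofReal_le_ofReal
            (exp_mul_norm_wig_shift_le hω hK hb hτ0 hτ1 hg hg' hlam hm₁ z z₁ z₂)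
      _ = ∫⁻ z₁, (ENNReal.ofReal c₀ * Y) *
            (‖stft g f z₁‖ₑ * ENNReal.ofReal (Real.exp (s * ω (phaseNorm z₁)))) := by
          refine lintegral_congr fun z₁ => ?_
          have : (∫⁻ z₂, ‖stft g f z₂‖ₑ * (ENNReal.ofReal c₀ *
              (ENNReal.ofReal (Real.exp (s * ω (phaseNorm z₁))) *
                ENNReal.ofReal (Real.exp (s * ω (phaseNorm z₂)))))) =
              ENNReal.ofReal c₀ * ENNReal.ofReal (Real.exp (s * ω (phaseNorm z₁))) * Y := by
            rw [hY, ← lintegral_const_mul' _ _ (by finiteness)]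
            refine lintegral_congr fun z₂ => ?_
            ring
          rw [this]
          ring
      _ = ENNReal.ofReal c₀ * Y ^ 2 := by
          have hmeas : Measurable fun z : RN N × RN N =>
              ‖stft g f z‖ₑ * ENNReal.ofReal (Real.exp (s * ω (phaseNorm z))) :=
            (stronglyMeasurable_stft hf.continuous hg.continuous).enorm.mul
              (Real.continuous_exp.comp
                (continuous_const.mul hω.continuous_phase)).measurable.ennreal_ofReal
          rw [lintegral_const_mul _ hmeas, sq, mul_assoc]
  -- The power `(2π)^{5N/2}` is `(2π)^{2N}` from two reconstructions times `(2π)^{N/2}` from the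
  -- geometric mean; the two reconstructions also give `‖g‖₂⁴`.
  have hconst : ENNReal.ofReal e₁ / (ENNReal.ofReal ((2 * Real.pi) ^ ((5 / 2 : ℝ) * (N : ℝ)) *
      (τ - τ ^ 2) ^ ((N : ℝ) / 2)) * eLpNorm g 2 volume ^ 4) * ENNReal.ofReal M =
      ENNReal.ofReal c₀ / ENNReal.ofReal (P * G) ^ 2 := by
    have r1 : (2 * Real.pi) ^ ((5 / 2 : ℝ) * (N : ℝ)) = P ^ 2 * √P := by
      rw [hP, sqrt_pow_eq_rpow (by positivity), ← pow_mul, ← Real.rpow_natCast,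
        ← Real.rpow_add (by positivity)]
      congr 1
      push_cast
      ring
    have r2 : (τ - τ ^ 2) ^ ((N : ℝ) / 2) = √D := (sqrt_pow_eq_rpow hd.le N).symm
    have r3 : eLpNorm g 2 volume ^ 4 = ENNReal.ofReal (G ^ 2) := by
      rw [show (4 : ℕ) = 2 * 2 from rfl, pow_mul, eLpNorm_two_sq_eq (hg.integrable_norm_sq hω),
        ENNReal.ofReal_pow hG0.le]
    rw [r1, r2, r3, ← ENNReal.ofReal_mul (by positivity), ← ENNReal.ofReal_div_of_pos (by positivity),
      ← ENNReal.ofReal_mul (by positivity), ← ENNReal.ofReal_pow (by positivity),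
      ← ENNReal.ofReal_div_of_pos (by positivity), hc₀]
    congr 1
    field_simp
  have hMe : ENNReal.ofReal (Real.exp (K * (1 + 2 * K) * (4 * K ^ 2 * lam + m₁))) *
        wNorm ω s g ∞ * wNorm ω s (fourierHat g) ∞ * expNormPhase N ω m₁ 2 = ENNReal.ofReal M := by
    have hE : expNormPhase N ω m₁ 2 < ∞ :=
      expNormPhase_lt_top hω hb two_ne_zero ENNReal.ofNat_ne_top (by
        rw [ENNReal.toReal_ofNat, mul_div_assoc]
        linarith)
    rw [hM, ENNReal.ofReal_mul (by positivity), ENNReal.ofReal_mul (by positivity),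
      ENNReal.ofReal_mul (by positivity), ENNReal.ofReal_toReal hE.ne,
      ENNReal.ofReal_toReal (hg.wNorm_lt_top s).ne, ENNReal.ofReal_toReal (hg'.wNorm_lt_top s).ne]
  have hX : wNormPhase ω (8 * K ^ 4 * lam + 2 * (K ^ 2 * m₁ + m₂)) (spectrogram g f) p =
      eLpNorm (fun z => Real.exp ((s + m₂) * ω (phaseNorm z)) • stft g f z) (2 * p) volume ^ 2 := by
    rw [eLpNorm_exp_stft_sq]
    congr 1
    rw [hs]
    ring
  have hPG : ENNReal.ofReal (P * G) ^ 2 ≠ 0 :=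
    pow_ne_zero _ (ENNReal.ofReal_pos.2 (by positivity)).ne'
  rw [hMe, ← mul_assoc (ENNReal.ofReal e₁ / _), hconst, hX, mul_assoc (_ / _), ← mul_pow,
    mul_comm (expNormPhase _ _ _ _)]
  rw [wNormPhase, eLpNorm_exponent_top]
  refine eLpNormEssSup_le_of_ae_enorm_bound (.of_forall fun z => ?_)
  rw [← ENNReal.mul_div_right_comm, ENNReal.le_div_iff_mul_le (.inl hPG) (.inl (by finiteness)),
    mul_comm]
  refine (hpt z).trans ?_
  gcongr

end WignerBound

/-! ### Admissible exponents, finiteness of the constants, and the conclusion -/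

theorem conjExponent_two_mul_ne_zero (p : ℝ≥0∞) : ENNReal.conjExponent (2 * p) ≠ 0 := by
  simp [ENNReal.conjExponent]

theorem conjExponent_two_mul_ne_top {p : ℝ≥0∞} (hp : 1 ≤ p) :
    ENNReal.conjExponent (2 * p) ≠ ∞ := by
  have h : 1 < 2 * p := by
    calc (1 : ℝ≥0∞) < 2 := ENNReal.one_lt_two
      _ ≤ 2 * p := le_mul_of_one_le_right zero_le hp
  simpa [ENNReal.conjExponent, tsub_eq_zero_iff_le] using h

theorem exists_admissible_exponents {K b r μ N : ℝ} (hK : 1 ≤ K) (hb : 0 < b) (hr : 0 < r)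
    (hμ : 2 * N / b * (K ^ 2 + 2 / r) < μ) :
    ∃ m₁ m₂ : ℝ, 2 * (K ^ 2 * m₁ + m₂) = μ ∧ N / b < m₁ ∧ 2 * N / (b * r) < m₂ := by
  set δ := μ - 2 * N / b * (K ^ 2 + 2 / r) with hδ
  have hδ0 : 0 < δ := sub_pos.2 hμ
  have hK0 : K ≠ 0 := by linarith
  -- At the two thresholds the constraint would give exactly the lower bound for `μ`. The excess `δ`
  -- is shared so that each exponent contributes `δ/2` to `μ`.
  refine ⟨N / b + δ / (4 * K ^ 2), 2 * N / (b * r) + δ / 4, ?_,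
    lt_add_of_pos_right _ (by positivity), lt_add_of_pos_right _ (by positivity)⟩
  rw [hδ]
  field_simp
  ring

theorem conjExponent_two_mul_toReal_pos {p : ℝ≥0∞} (hp : 1 ≤ p) :
    0 < (ENNReal.conjExponent (2 * p)).toReal :=
  ENNReal.toReal_pos (conjExponent_two_mul_ne_zero p) (conjExponent_two_mul_ne_top hp)

theorem constD6_factor_ne_top {N : ℕ} {ω : ℝ → ℝ} (hω : IsWeightFunction ω) {τ : ℝ} (hτ0 : 0 < τ)
    (hτ1 : τ < 1) {g : RN N → ℂ} (hg : HasExpDecay ω g) (hg0 : g ≠ 0) (x : ℝ) :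
    ENNReal.ofReal x / (ENNReal.ofReal ((2 * Real.pi) ^ ((5 / 2 : ℝ) * (N : ℝ)) *
      (τ - τ ^ 2) ^ ((N : ℝ) / 2)) * eLpNorm g 2 volume ^ 4) ≠ ∞ := by
  have hd : 0 < τ - τ ^ 2 := by nlinarith
  have h4 : eLpNorm g 2 volume ^ 2 ≠ 0 := by
    rw [eLpNorm_two_sq_eq (hg.integrable_norm_sq hω)]
    exact (ENNReal.ofReal_pos.2 (integral_norm_sq_pos hω hg hg0)).ne'
  refine (ENNReal.div_lt_top ENNReal.ofReal_ne_top
    (mul_ne_zero (ENNReal.ofReal_pos.2 (by positivity)).ne' ?_)).ne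
  rw [show (4 : ℕ) = 2 * 2 from rfl, pow_mul]
  exact pow_ne_zero _ h4

theorem constD6_lt_top {N : ℕ} {ω : ℝ → ℝ} (hω : IsWeightFunction ω) {K a b : ℝ}
    (hK : WeightAlpha ω K) (hb : WeightGamma ω a b) {p : ℝ≥0∞} (hp : 1 ≤ p) {τ : ℝ} (hτ0 : 0 < τ)
    (hτ1 : τ < 1) {g : RN N → ℂ} (hg : HasExpDecay ω g) (hg' : HasExpDecay ω (fourierHat g))
    (hg0 : g ≠ 0) (lam : ℝ) {μ : ℝ}
    (hμ : 2 * (N : ℝ) / b * (K ^ 2 + 2 / (ENNReal.conjExponent (2 * p)).toReal) < μ) :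
    constD6 ω K b p τ g lam μ < ∞ := by
  have hr0 := conjExponent_two_mul_toReal_pos hp
  obtain ⟨m₁, m₂, h⟩ := exists_admissible_exponents hK.1 hb.1 hr0 hμ
  rw [constD6]
  refine ENNReal.mul_lt_top (constD6_factor_ne_top hω hτ0 hτ1 hg hg0 _).lt_top
    ((iInf_le_of_le m₁ (iInf_le_of_le m₂ (iInf_le _ h))).trans_lt ?_)
  have hE1 : expNormPhase N ω m₁ 2 < ∞ :=
    expNormPhase_lt_top hω hb two_ne_zero ENNReal.ofNat_ne_top (by
      rw [ENNReal.toReal_ofNat, mul_div_assoc]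
      linarith [h.2.1])
  have hE2 : expNormPhase N ω m₂ (ENNReal.conjExponent (2 * p)) < ∞ :=
    expNormPhase_lt_top hω hb (conjExponent_two_mul_ne_zero p) (conjExponent_two_mul_ne_top hp) (by
      rw [← div_lt_iff₀ hr0, div_div]
      exact h.2.2)
  exact ENNReal.mul_lt_top (ENNReal.mul_lt_top (ENNReal.mul_lt_top (ENNReal.mul_lt_top
    ENNReal.ofReal_lt_top (hg.wNorm_lt_top _)) (hg'.wNorm_lt_top _)) hE1) (ENNReal.pow_lt_top hE2)

/-- A bound by a constant times each member of a family passes to the infimum. -/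
theorem ENNReal.le_mul_mul_of_forall_le {ι : Sort*} {A c X Q : ℝ≥0∞} {T : ι → ℝ≥0∞} (hc : c ≠ ∞)
    (hX : X ≠ ∞) (hne : Nonempty ι) (hQ : ∀ y, (∀ i, y ≤ T i) → y ≤ Q)
    (h : ∀ i, A ≤ c * T i * X) : A ≤ c * Q * X := by
  -- If `c * X = 0`, division is impossible, but any single member of the family already forces `A =
  -- 0`; this is where nonemptiness enters.
  rcases eq_or_ne (c * X) 0 with h0 | h0
  · have := h hne.some
    rw [mul_right_comm, h0, zero_mul] at this
    exact this.trans zero_le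
  · rw [mul_right_comm, mul_comm, ← ENNReal.div_le_iff h0 (ENNReal.mul_ne_top hc hX)]
    refine hQ _ fun i => ?_
    rw [ENNReal.div_le_iff h0 (ENNReal.mul_ne_top hc hX), mul_comm, mul_right_comm]
    exact h i

theorem mainTheorem5 (N : ℕ) (ω : ℝ → ℝ) (hω : IsWeightFunction ω)
    (K a b : ℝ) (hK : WeightAlpha ω K) (hb : WeightGamma ω a b)
    (p : ℝ≥0∞) (hp : 1 ≤ p) (τ : ℝ) (hτ0 : 0 < τ) (hτ1 : τ < 1)
    (g : RN N → ℂ) (hg : MemSω ω g) (hg0 : g ≠ 0) :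
    (∀ lam : ℝ, 0 ≤ lam →
      constD5 ω K p τ g lam < ∞ ∧
      ∀ f : RN N → ℂ, MemSω ω f →
        wNormPhase ω (K * lam) (wig τ f) p < ∞ ∧
        wNormPhase ω lam (spectrogram g f) ∞ ≤
          constD5 ω K p τ g lam * wNormPhase ω (K * lam) (wig τ f) p) ∧
    (∀ lam : ℝ, 0 ≤ lam → ∀ μ : ℝ,
      2 * (N : ℝ) / b * (K ^ 2 + 2 / (ENNReal.conjExponent (2 * p)).toReal) < μ →
      constD6 ω K b p τ g lam μ < ∞ ∧
      ∀ f : RN N → ℂ, MemSω ω f →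
        wNormPhase ω (8 * K ^ 4 * lam + μ) (spectrogram g f) p < ∞ ∧
        wNormPhase ω lam (wig τ f) ∞ ≤
          constD6 ω K b p τ g lam μ *
            wNormPhase ω (8 * K ^ 4 * lam + μ) (spectrogram g f) p) := by
  have hgd := hg.hasExpDecay hω
  have hgd' := hg.hasExpDecay_hat hω
  refine ⟨fun lam hlam => ⟨?_, fun f hf => ?_⟩, fun lam hlam μ hμ => ⟨?_, fun f hf => ?_⟩⟩
  · have hr : HasExpDecay ω (fourierHat fun t => g (-t)) := by
      rw [fourierHat_comp_neg]
      exact hgd'.comp_neg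
    refine ENNReal.mul_lt_top ENNReal.ofReal_lt_top (wNormPhase_lt_top hω
      (exists_exp_mul_norm_wig_le hω (by linarith) (by linarith) hgd.comp_neg hr) _ ?_)
    exact le_self_add
  · have hfd := hf.hasExpDecay hω
    have hfd' := hf.hasExpDecay_hat hω
    exact ⟨wNormPhase_lt_top hω (exists_exp_mul_norm_wig_le hω hτ0 hτ1 hfd hfd') _ hp,
      wNormPhase_top_spectrogram_le hω hK hp hτ0 hτ1 hfd hfd' hgd hlam⟩
  · exact constD6_lt_top hω hK hb hp hτ0 hτ1 hgd hgd' hg0 lam hμ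
  · have hfd := hf.hasExpDecay hω
    have hfd' := hf.hasExpDecay_hat hω
    have hfin := wNormPhase_lt_top hω
      (exists_exp_mul_norm_spectrogram_le hω hfd hfd' hgd hgd') (8 * K ^ 4 * lam + μ) hp
    refine ⟨hfin, ?_⟩
    have hex := exists_admissible_exponents hK.1 hb.1 (conjExponent_two_mul_toReal_pos hp) hμ
    rw [constD6]
    -- The nested infimum over `m₁`, `m₂` and the constraints is handled as one infimum over a
    -- subtype; only its greatest-lower-bound property has to be supplied.
    refine ENNReal.le_mul_mul_of_forall_le
      (ι := {m : ℝ × ℝ // 2 * (K ^ 2 * m.1 + m.2) = μ ∧ (N : ℝ) / b < m.1 ∧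
        2 * (N : ℝ) / (b * (ENNReal.conjExponent (2 * p)).toReal) < m.2})
      (T := fun m => ENNReal.ofReal (Real.exp (K * (1 + 2 * K) * (4 * K ^ 2 * lam + m.1.1))) *
        wNorm ω (K ^ 2 * (4 * K ^ 2 * lam + m.1.1)) g ∞ *
        wNorm ω (K ^ 2 * (4 * K ^ 2 * lam + m.1.1)) (fourierHat g) ∞ *
        expNormPhase N ω m.1.1 2 *
        expNormPhase N ω m.1.2 (ENNReal.conjExponent (2 * p)) ^ 2)
      (constD6_factor_ne_top hω hτ0 hτ1 hgd hg0 _) hfin.ne ?_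
      (fun y hy => le_iInf fun m₁ => le_iInf fun m₂ => le_iInf fun h => hy ⟨(m₁, m₂), h⟩)
      fun m => ?_
    · obtain ⟨m₁, m₂, h⟩ := hex
      exact ⟨⟨(m₁, m₂), h⟩⟩
    · obtain ⟨⟨m₁, m₂⟩, h1, h2, h3⟩ := m
      have := wNormPhase_top_wig_le hω hK hb hp hτ0 hτ1 hfd hfd' hgd hgd' hg0 hlam h2 m₂
      rwa [h1] at this
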